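/- **Setting.** For $\lambda>1$ let $\mathbb T_\lambda=\mathbb R/(2\pi\lambda\mathbb Z)$, and write $\hat u(\xi,q,\tau)$, $(\xi,q,\tau)\in\mathbb R\times\mathbb Z/\lambda\times\mathbb R$, for the ($L^2$) Fourier transform $\int e^{-i(t\tau+x\xi+yq)}u(x,y,t)\,dx\,dy\,dt$ of a complex-valued function $u$ on $\mathbb R\times\mathbb T_\lambda\times\mathbb R$. Put $\zeta=(\xi,q)$, $|\zeta|^2=3\xi^2+q^2$, $\sigma(\zeta)=\xi^3+\xi q^2$, $\langle a\rangle=1+|a|$, and $$\|u\|_{X^{1,b}_\lambda}=\Big(\frac1\lambda\sum_{q\in\mathbb Z/\lambda}\int_{\mathbb R^2}\langle\tau-\sigma(\zeta)\rangle^{2b}\,\langle|\zeta|\rangle^{2}\,|\hat u(\xi,q,\tau)|^2\,d\xi\,d\tau\Big)^{1/2}.$$ For $N\in\{2^k:k=0,1,2,\dots\}$ let $I$ be the Fourier multiplier operator $\widehat{If}=m(\zeta)\hat f$, where $m:\mathbb R^2\to\mathbb R$ is any smooth function that is radially symmetric and non-increasing with respect to $|\zeta|$, with $m(\zeta)=1$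 for $|\zeta|\le N$ and $m(\zeta)=(|\zeta|/N)^{s-1}$ for $|\zeta|\ge 2N$. **Lemma 4.4.** Let $s>31/40$. There is $\varepsilon>0$ such that for every $b>1/2$ there is a constant $C>0$ such that, for all $\lambda>1$, all $N\in\{2^k:k\ge0\}$, all $m$ as above and all $u\in L^2(\mathbb R\times\mathbb T_\lambda\times\mathbb R)$ with $Iu\in X^{1,b}_\lambda$: the functions $u^2$ and $(Iu)^2$ are square-integrable, the integral below exists, and $$\Big|\int_{\mathbb R\times\mathbb T_\lambda\times\mathbb R} I(u^2)\,\partial_x\big((Iu)^2-I(u^2)\big)\,dx\,dy\,dt\Big|\le \frac{C}{N^{1/10+\varepsilon}}\,\|Iu\|_{X^{1,b}_\lambda}^4 .$$ Here $\partial_x$ is the distributional derivative, and $\int f\,\partial_x g\,dx\,dy\,dt$ for $f,g\in L^2$ is read as $\lim_{r\to0}\int f(x,y,t)\,\frac{g(x+r,y,t)-g(x,y,t)}{r}\,dx\,dy\,dt$; this is the usual integral of $f$ times the function $\partial_xg$ whenever $\partial_x g\in L^2$. -/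

import Mathlib

open MeasureTheory Filter Topology
open scoped ENNReal ContDiff

noncomputable section

namespace ZK

/-- The space-time cylinder `ℝ × 𝕋_lam × ℝ`, `𝕋_lam = ℝ / (2 π lam ℤ)`, with points `(x, y, t)`
and its Lebesgue measure `volume = dx dy dt` (the circle has total mass `2 π lam`). -/
abbrev Cyl (lam : ℝ) : Type := ℝ × AddCircle (2 * Real.pi * lam) × ℝ

/-- The frequency space `ℝ × (ℤ / lam) × ℝ`: the triple `(ξ, k, τ)` stands for `(ξ, q, τ)` with
`q = k / lam`. -/
abbrev Freq : Type := ℝ × ℤ × ℝ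

/-- The measure `(1 / lam) ∑_{q ∈ ℤ / lam} ∫∫ dξ dτ` on the frequency space. -/
def freqMeasure (lam : ℝ) : Measure Freq :=
  ENNReal.ofReal lam⁻¹ •
    (volume : Measure ℝ).prod ((Measure.count : Measure ℤ).prod (volume : Measure ℝ))

/-- The spatial frequency `ζ = (ξ, q) = (ξ, k / lam)`. -/
def zeta (lam : ℝ) (z : Freq) : ℝ × ℝ := (z.1, (z.2.1 : ℝ) / lam)

/-- The absolute value `|(ξ, q)|`, where `|(ξ, q)|² = 3 ξ² + q²`. -/
def absz (ζ : ℝ × ℝ) : ℝ := Real.sqrt (3 * ζ.1 ^ 2 + ζ.2 ^ 2)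

/-- The bracket `⟨x⟩ = 1 + |x|`. -/
def bracket (x : ℝ) : ℝ := 1 + |x|

/-- The dispersion relation `σ(ξ, q) = ξ³ + ξ q²`. -/
def sigma (ζ : ℝ × ℝ) : ℝ := ζ.1 ^ 3 + ζ.1 * ζ.2 ^ 2

section Transform

variable {lam : ℝ} [Fact (0 < 2 * Real.pi * lam)]

/-- The Fourier integral of `u` restricted to `|x| ≤ R`, `|t| ≤ R`:
`∫_{|x|, |t| ≤ R} ∫_{𝕋_lam} e^{-i (t τ + x ξ + y q)} u(x, y, t) dx dy dt`.
Here `fourier (-k) y = e^{-2 π i k y / (2 π lam)} = e^{-i y q}`. -/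
def truncFourier (u : Cyl lam → ℂ) (R : ℝ) (z : Freq) : ℂ :=
  ∫ p in {p : Cyl lam | |p.1| ≤ R ∧ |p.2.2| ≤ R},
    Complex.exp (-Complex.I * ((p.2.2 * z.2.2 + p.1 * z.1 : ℝ) : ℂ)) *
      fourier (-z.2.1) p.2.1 * u p

/-- `U` is the Fourier transform of the square-integrable function `u`: the limit in `L²` of the
truncated Fourier integrals (for integrable `u` it is given by the usual integral). -/
def IsFourier (u : Cyl lam → ℂ) (U : Freq → ℂ) : Prop :=
  MemLp U 2 (freqMeasure lam) ∧
    Tendsto (fun R : ℝ => eLpNorm (fun z => truncFourier u R z - U z) 2 (freqMeasure lam))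
      atTop (𝓝 0)

/-- The (`L²`) space-time Fourier transform. By Plancherel's theorem it exists for every
`u ∈ L²`, and it is unique up to null sets. -/
def fourierL2 (u : Cyl lam → ℂ) : Freq → ℂ := Classical.epsilon (IsFourier u)

/-- The norm of the Bourgain space `X^{s,b}_lam`, with the value `∞` outside of the space:
`‖u‖² = (1 / lam) ∑_q ∫∫ ⟨τ - σ(ξ, q)⟩^{2 b} ⟨|(ξ, q)|⟩^{2 s} |û(ξ, q, τ)|² dξ dτ`. -/
def bourgainNorm (s b : ℝ) (u : Cyl lam → ℂ) : ℝ≥0∞ :=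
  (∫⁻ z, ENNReal.ofReal (bracket (z.2.2 - sigma (zeta lam z)) ^ (2 * b) *
      bracket (absz (zeta lam z)) ^ (2 * s) * ‖fourierL2 u z‖ ^ 2) ∂(freqMeasure lam)) ^
    (1 / 2 : ℝ)

/-- `w` is the image of `u` under the Fourier multiplier operator with symbol `m(ξ, q)`. -/
def IsMultiplierImage (m : ℝ × ℝ → ℝ) (u w : Cyl lam → ℂ) : Prop :=
  MemLp w 2 volume ∧
    fourierL2 w =ᵐ[freqMeasure lam] fun z => (m (zeta lam z) : ℂ) * fourierL2 u z

/-- The Fourier multiplier operator on `L²` with bounded symbol `m(ξ, q)`, acting in the spatial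
variables; its value is unique up to null sets. -/
def multiplierOp (m : ℝ × ℝ → ℝ) (u : Cyl lam → ℂ) : Cyl lam → ℂ :=
  Classical.epsilon (IsMultiplierImage m u)

/-- The difference quotient `(g(x + r, y, t) - g(x, y, t)) / r`. -/
def diffQuotX (g : Cyl lam → ℂ) (r : ℝ) (p : Cyl lam) : ℂ :=
  (g (p.1 + r, p.2) - g p) / (r : ℂ)

/-- `J` is the value of `∫ f ∂_x g dx dy dt` for `f, g ∈ L²`, where `∂_x g` is the distributional
derivative, which need not be a function. The integral is read as the limit of
`∫ f (g(x + r, y, t) - g(x, y, t)) / r dx dy dt` as `r → 0`; whenever `∂_x g` belongs to `L²`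
this is the integral of `f` times the function `∂_x g`. -/
def HasIntegralMulDx (f g : Cyl lam → ℂ) (J : ℂ) : Prop :=
  (∀ r : ℝ, r ≠ 0 → Integrable (fun p => f p * diffQuotX g r p) volume) ∧
    Tendsto (fun r : ℝ => ∫ p, f p * diffQuotX g r p) (𝓝[≠] 0) (𝓝 J)

end Transform

/-- The symbols `m` of the operator `I` with parameters `s` and `N`: smooth, radially symmetric
and non-increasing (with respect to `|ζ|² = 3 ξ² + q²`), equal to `1` for `|ζ| ≤ N` and to
`(|ζ| / N)^{s - 1}` for `|ζ| ≥ 2 N`. -/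
structure IsISymbol (s N : ℝ) (m : ℝ × ℝ → ℝ) : Prop where
  smooth : ContDiff ℝ ∞ m
  radial : ∀ ζ ζ' : ℝ × ℝ, absz ζ = absz ζ' → m ζ = m ζ'
  anti : ∀ ζ ζ' : ℝ × ℝ, absz ζ ≤ absz ζ' → m ζ' ≤ m ζ
  low : ∀ ζ : ℝ × ℝ, absz ζ ≤ N → m ζ = 1
  high : ∀ ζ : ℝ × ℝ, 2 * N ≤ absz ζ → m ζ = (absz ζ / N) ^ (s - 1)

end ZK

end

/-! The estimate needs no dispersive smoothing: on the Fourier side it reduces to Cauchy–Schwarz and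
an integrable weight. By Parseval the weak integral of `f ∂ₓ g` is, up to a constant, the integral
of `i ξ f̂(-z) ĝ(z)`, where `f = I(u²)` and `g = (Iu)² - I(u²)`. Products become convolutions, so
`f̂` and `ĝ` are bilinear in `û`, with symbols `m(ζ₁ + ζ₂)` and `m(ζ₁) m(ζ₂) - m(ζ₁ + ζ₂)`.

Split `|ξ| = |ξ|^(s - 9/40) |ξ|^(49/40 - s)`. The first power goes to `f̂`, where subadditivity
bounds it by `⟨ζ₁⟩^(s - 9/40) + ⟨ζ₂⟩^(s - 9/40)`. The second goes to `ĝ`. There the commutator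
symbol vanishes unless the larger frequency `M` is at least of order `N`, so a factor `(M/N)^(2s -
29/20)` can be inserted. This yields the decay in `N` and raises the power of `M` to the same `s -
9/40` (`IsISymbol.commutator_le`). Both factors are thus bounded by one weighted self-convolution of
`|û|`.

That convolution is bounded in `L²` by `‖⟨τ - σ⟩^b ⟨ζ⟩^s û‖²`
(`lintegral_sq_convolution_pairWeight_le`). After Cauchy–Schwarz all spatial decay can be put on the
smaller frequency, which leaves the weight `⟨ζ⟩^(-(2s + 9/20)) ⟨τ - σ⟩^(-2b)`. In two space
frequencies it is integrable when `2s + 9/20 > 2`, that is `s > 31/40`, and the `τ` integral needs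
`b > 1/2`. Finally `⟨ζ⟩^(s - 1) ≤ 2 m(ζ)` turns the `s`-weighted norm of `û` into the norm of `Iu`.

The rest is `L²` Fourier analysis on the cylinder: since the transform and the multiplier operator
are chosen by `epsilon`, existence, uniqueness, inversion and the convolution theorem
(`memLp_mul_and_fourierL2_mul`) have to be established. -/

open scoped NNReal

namespace ZK

/-! ### Kernels with a Plancherel identity and their tensor products -/

/-- A bounded measurable kernel whose integral operator satisfies Plancherel's identity with
constant `c` on integrable and square-integrable functions. -/
structure PlancherelKernel {X Y : Type*} [MeasurableSpace X] [MeasurableSpace Y]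
    (μ : Measure X) (ν : Measure Y) (κ : Y → X → ℂ) (c : ℝ≥0) : Prop where
  meas : Measurable (Function.uncurry κ)
  norm_le : ∀ y x, ‖κ y x‖ ≤ 1
  plancherel : ∀ f : X → ℂ, Integrable f μ → MemLp f 2 μ →
    ∫⁻ y, ‖∫ x, κ y x * f x ∂μ‖ₑ ^ 2 ∂ν = c * ∫⁻ x, ‖f x‖ₑ ^ 2 ∂μ

theorem memLp_two_iff_lintegral {X : Type*} [MeasurableSpace X] {μ : Measure X} {f : X → ℂ} :
    MemLp f 2 μ ↔ AEStronglyMeasurable f μ ∧ ∫⁻ x, ‖f x‖ₑ ^ 2 ∂μ < ⊤ := by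
  unfold MemLp
  rw [eLpNorm_lt_top_iff_lintegral_rpow_enorm_lt_top (by norm_num) (by norm_num)]
  simp

namespace PlancherelKernel

variable {X Y X₁ X₂ Y₁ Y₂ : Type*} [MeasurableSpace X] [MeasurableSpace Y]
  [MeasurableSpace X₁] [MeasurableSpace X₂] [MeasurableSpace Y₁] [MeasurableSpace Y₂]
  {μ : Measure X} {ν : Measure Y} {κ : Y → X → ℂ} {c : ℝ≥0}

theorem meas_left (h : PlancherelKernel μ ν κ c) (y : Y) : Measurable (κ y) :=
  h.meas.comp measurable_prodMk_left

theorem integrable_mul (h : PlancherelKernel μ ν κ c) {f : X → ℂ} (hf : Integrable f μ) (y : Y) :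
    Integrable (fun x => κ y x * f x) μ :=
  hf.bdd_mul (h.meas_left y).aestronglyMeasurable (ae_of_all _ (h.norm_le y))

theorem star (h : PlancherelKernel μ ν κ c) :
    PlancherelKernel μ ν (fun y x => starRingEnd ℂ (κ y x)) c where
  meas := Complex.continuous_conj.measurable.comp h.meas
  norm_le y x := by simpa using h.norm_le y x
  plancherel f hf hf2 := by
    have := h.plancherel (fun x => starRingEnd ℂ (f x))
      (hf.norm.mono' (Complex.continuous_conj.comp_aestronglyMeasurable hf.1)
        (ae_of_all _ fun x => by simp))
      (by
        refine hf2.of_le (Complex.continuous_conj.comp_aestronglyMeasurable hf2.1) ?_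
        exact ae_of_all _ fun x => by simp)
    have e : ∀ y, ‖∫ x, starRingEnd ℂ (κ y x) * f x ∂μ‖ₑ
        = ‖∫ x, κ y x * starRingEnd ℂ (f x) ∂μ‖ₑ := by
      intro y
      have : ∫ x, starRingEnd ℂ (κ y x) * f x ∂μ
          = starRingEnd ℂ (∫ x, κ y x * starRingEnd ℂ (f x) ∂μ) := by
        rw [← integral_conj]
        simp
      rw [this, RCLike.enorm_conj]
    simp_rw [e, this, RCLike.enorm_conj]

/-- The squared transform scales by `a²` and the squared norm on the right only by `a`, hence the
new constant. For `a = 0` integrability could not be carried back to `μ`. -/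
theorem smul_left (h : PlancherelKernel μ ν κ c) (a : ℝ≥0) (ha : a ≠ 0) :
    PlancherelKernel (a • μ) ν κ (a * c) where
  meas := h.meas
  norm_le := h.norm_le
  plancherel f hf hf2 := by
    have h1 : Integrable f μ := (integrable_smul_measure (by simpa using ha) (by simp)).1 hf
    have h2 : MemLp f 2 μ := by
      rw [memLp_two_iff_lintegral] at hf2 ⊢
      refine ⟨h1.1, ?_⟩
      have := hf2.2
      rw [lintegral_smul_measure] at this
      by_contra h'
      rw [not_lt_top_iff.1 h', ENNReal.smul_def, smul_eq_mul,
        ENNReal.mul_top (by simpa using ha)] at this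
      exact this.ne rfl
    have := h.plancherel f h1 h2
    simp_rw [integral_smul_nnreal_measure, NNReal.smul_def, enorm_smul, mul_pow]
    rw [lintegral_const_mul' _ _ (by simp), this, lintegral_smul_measure]
    have ea : ‖(a : ℝ)‖ₑ = (a : ℝ≥0∞) := by
      rw [Real.enorm_eq_ofReal (NNReal.coe_nonneg a), ENNReal.ofReal_coe_nnreal]
    simp only [ea, ENNReal.smul_def, smul_eq_mul, ENNReal.coe_mul]
    ring

theorem smul_right (h : PlancherelKernel μ ν κ c) (a : ℝ≥0) :
    PlancherelKernel μ (a • ν) κ (a * c) where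
  meas := h.meas
  norm_le := h.norm_le
  plancherel f hf hf2 := by
    rw [lintegral_smul_measure, h.plancherel f hf hf2]
    simp only [ENNReal.smul_def, smul_eq_mul, ENNReal.coe_mul]
    ring

theorem aestronglyMeasurable_integral [SFinite μ] (h : PlancherelKernel μ ν κ c) {f : X → ℂ}
    (hf : AEStronglyMeasurable f μ) : StronglyMeasurable fun y => ∫ x, κ y x * f x ∂μ := by
  have e : (fun y => ∫ x, κ y x * f x ∂μ) = fun y => ∫ x, κ y x * hf.mk f x ∂μ := by
    funext y
    refine integral_congr_ae ?_
    filter_upwards [hf.ae_eq_mk] with x hx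
    rw [hx]
  rw [e]
  refine StronglyMeasurable.integral_prod_right (f := fun y x => κ y x * hf.mk f x) ?_
  exact h.meas.stronglyMeasurable.mul (hf.stronglyMeasurable_mk.comp_measurable measurable_snd)

/-- Transform in the first variable with the second frozen, then in the second; Tonelli joins the
two one-variable identities. -/
theorem prod {μ₁ : Measure X₁} {μ₂ : Measure X₂} {ν₁ : Measure Y₁} {ν₂ : Measure Y₂}
    [SFinite μ₁] [SFinite μ₂] [SFinite ν₁] [SFinite ν₂]
    {κ₁ : Y₁ → X₁ → ℂ} {κ₂ : Y₂ → X₂ → ℂ} {c₁ c₂ : ℝ≥0}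
    (h₁ : PlancherelKernel μ₁ ν₁ κ₁ c₁) (h₂ : PlancherelKernel μ₂ ν₂ κ₂ c₂) :
    PlancherelKernel (μ₁.prod μ₂) (ν₁.prod ν₂) (fun y x => κ₁ y.1 x.1 * κ₂ y.2 x.2)
      (c₁ * c₂) := by
  have hmeas : Measurable (Function.uncurry
      (fun (y : Y₁ × Y₂) (x : X₁ × X₂) => κ₁ y.1 x.1 * κ₂ y.2 x.2)) := by
    have m1 := h₁.meas
    have m2 := h₂.meas
    exact (m1.comp (f := fun p : (Y₁ × Y₂) × (X₁ × X₂) => (p.1.1, p.2.1)) (by fun_prop)).mul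
      (m2.comp (f := fun p : (Y₁ × Y₂) × (X₁ × X₂) => (p.1.2, p.2.2)) (by fun_prop))
  have hle : ∀ (y : Y₁ × Y₂) (x : X₁ × X₂), ‖κ₁ y.1 x.1 * κ₂ y.2 x.2‖ ≤ 1 := fun y x => by
    rw [norm_mul]
    exact mul_le_one₀ (h₁.norm_le _ _) (norm_nonneg _) (h₂.norm_le _ _)
  refine ⟨hmeas, hle, fun f hf hf2 => ?_⟩
  wlog hfm : StronglyMeasurable f generalizing f
  · have := this (hf.1.mk f) (hf.congr hf.1.ae_eq_mk) (hf2.ae_eq hf.1.ae_eq_mk)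
      hf.1.stronglyMeasurable_mk
    have e1 : ∫⁻ x, ‖f x‖ₑ ^ 2 ∂(μ₁.prod μ₂) = ∫⁻ x, ‖hf.1.mk f x‖ₑ ^ 2 ∂(μ₁.prod μ₂) := by
      refine lintegral_congr_ae ?_
      filter_upwards [hf.1.ae_eq_mk] with x hx
      rw [hx]
    rw [e1, ← this]
    refine lintegral_congr fun y => ?_
    congr 2
    refine integral_congr_ae ?_
    filter_upwards [hf.1.ae_eq_mk] with x hx
    rw [hx]
  set v : Y₁ → X₂ → ℂ := fun y x₂ => ∫ x₁, κ₁ y x₁ * f (x₁, x₂) ∂μ₁ with hv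
  have hvm : StronglyMeasurable (Function.uncurry v) := by
    refine StronglyMeasurable.integral_prod_left
      (f := fun (x₁ : X₁) (p : Y₁ × X₂) => κ₁ p.1 x₁ * f (x₁, p.2)) ?_
    refine StronglyMeasurable.mul ?_ ?_
    · exact (h₁.meas.comp (f := fun q : X₁ × (Y₁ × X₂) => (q.2.1, q.1))
        (by fun_prop)).stronglyMeasurable
    · exact hfm.comp_measurable (g := fun q : X₁ × (Y₁ × X₂) => (q.1, q.2.2)) (by fun_prop)
  have hL2 := (memLp_two_iff_lintegral.1 hf2).2
  have hfe : Measurable fun x => ‖f x‖ₑ ^ 2 := hfm.measurable.enorm.pow_const 2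
  rw [lintegral_prod_symm _ hfe.aemeasurable] at hL2
  have ha : ∀ᵐ x₂ ∂μ₂, ∫⁻ y, ‖v y x₂‖ₑ ^ 2 ∂ν₁ = c₁ * ∫⁻ x₁, ‖f (x₁, x₂)‖ₑ ^ 2 ∂μ₁ := by
    filter_upwards [hf.prod_left_ae, ae_lt_top hfe.lintegral_prod_left' hL2.ne] with x₂ hx hx'
    exact h₁.plancherel _ hx (memLp_two_iff_lintegral.2 ⟨hx.1, hx'⟩)
  have hve : Measurable fun p : Y₁ × X₂ => ‖v p.1 p.2‖ₑ ^ 2 := hvm.measurable.enorm.pow_const 2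
  have hb : ∫⁻ y, ∫⁻ x₂, ‖v y x₂‖ₑ ^ 2 ∂μ₂ ∂ν₁ = c₁ * ∫⁻ x, ‖f x‖ₑ ^ 2 ∂(μ₁.prod μ₂) := by
    rw [lintegral_lintegral_swap hve.aemeasurable, lintegral_congr_ae ha,
      lintegral_const_mul' _ _ (by simp), lintegral_prod_symm _ hfe.aemeasurable]
  -- Since `‖κ₁‖ ≤ 1`, the partial transform is dominated by the partial `L¹` norm of `f`, so this
  -- holds for every `y`, with no exceptional set.
  have hvint : ∀ y, Integrable (v y) μ₂ := by
    intro y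
    refine (hf.integral_norm_prod_right).mono' ?_ ?_
    · exact (hvm.comp_measurable measurable_prodMk_left).aestronglyMeasurable
    · filter_upwards [hf.prod_left_ae] with x₂ hx
      refine norm_integral_le_of_norm_le hx.norm (ae_of_all _ fun x₁ => ?_)
      rw [norm_mul]
      exact mul_le_of_le_one_left (norm_nonneg _) (h₁.norm_le _ _)
  have hc : ∀ᵐ y ∂ν₁, ∫⁻ y₂, ‖∫ x₂, κ₂ y₂ x₂ * v y x₂ ∂μ₂‖ₑ ^ 2 ∂ν₂
      = c₂ * ∫⁻ x₂, ‖v y x₂‖ₑ ^ 2 ∂μ₂ := by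
    have : ∫⁻ y, ∫⁻ x₂, ‖v y x₂‖ₑ ^ 2 ∂μ₂ ∂ν₁ ≠ ⊤ := by
      rw [hb, lintegral_prod_symm _ hfe.aemeasurable]
      exact ENNReal.mul_ne_top (by simp) hL2.ne
    filter_upwards [ae_lt_top hve.lintegral_prod_right' this] with y hy
    exact h₂.plancherel _ (hvint y) (memLp_two_iff_lintegral.2 ⟨(hvint y).1, hy⟩)
  have hd : ∀ y : Y₁ × Y₂, ∫ x, κ₁ y.1 x.1 * κ₂ y.2 x.2 * f x ∂(μ₁.prod μ₂)
      = ∫ x₂, κ₂ y.2 x₂ * v y.1 x₂ ∂μ₂ := by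
    intro y
    rw [integral_prod_symm]
    · refine integral_congr_ae (ae_of_all _ fun x₂ => ?_)
      simp only [hv]
      rw [← integral_const_mul]
      refine integral_congr_ae (ae_of_all _ fun x₁ => ?_)
      simp only
      ring
    · exact hf.bdd_mul (hmeas.comp measurable_prodMk_left).aestronglyMeasurable
        (ae_of_all _ (hle y))
  simp_rw [hd]
  have hm : Measurable fun y : Y₁ × Y₂ => ‖∫ x₂, κ₂ y.2 x₂ * v y.1 x₂ ∂μ₂‖ₑ ^ 2 := by
    refine (StronglyMeasurable.measurable ?_).enorm.pow_const 2
    refine StronglyMeasurable.integral_prod_right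
      (f := fun (y : Y₁ × Y₂) (x₂ : X₂) => κ₂ y.2 x₂ * v y.1 x₂) ?_
    refine StronglyMeasurable.mul ?_ ?_
    · exact (h₂.meas.comp (f := fun q : (Y₁ × Y₂) × X₂ => (q.1.2, q.2))
        (by fun_prop)).stronglyMeasurable
    · exact hvm.comp_measurable (g := fun q : (Y₁ × Y₂) × X₂ => (q.1.1, q.2)) (by fun_prop)
  rw [lintegral_prod _ hm.aemeasurable]
  rw [lintegral_congr_ae hc, lintegral_const_mul' _ _ (by simp), hb]
  push_cast
  ring

end PlancherelKernel

/-! ### Plancherel on the line and on the circle -/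

open FourierTransform SchwartzMap

/-- The `L²` transform is characterised through tempered distributions and the other side is an
integral. Both have the same pairing with every test function, by the multiplication formula `∫ ψ̂ f
= ∫ ψ f̂`. -/
theorem fourier_toLp_ae_eq {f : ℝ → ℂ} (hf : Integrable f) (hf2 : MemLp f 2) :
    (𝓕 (hf2.toLp f) : Lp ℂ 2 (volume : Measure ℝ)) =ᵐ[volume] 𝓕 f := by
  have hc : Continuous (𝓕 f) := VectorFourier.fourierIntegral_continuous
    Real.continuous_fourierChar (innerSL ℝ).continuous₂ hf
  set G : Lp ℂ 2 (volume : Measure ℝ) := 𝓕 (hf2.toLp f) with hG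
  have hGl : LocallyIntegrable (G : ℝ → ℂ) volume := (Lp.memLp G).locallyIntegrable (by norm_num)
  have key : ∀ᵐ x : ℝ, (G x - 𝓕 f x : ℂ) = 0 := by
    refine ae_eq_zero_of_integral_contDiff_smul_eq_zero
      (f := fun x => (G x - 𝓕 f x : ℂ)) (hGl.sub hc.locallyIntegrable) fun φ hφ hφc => ?_
    let ψ : 𝓢(ℝ, ℂ) := HasCompactSupport.toSchwartzMap (f := fun x => (φ x : ℂ))
      (hφc.comp_left (g := ((↑) : ℝ → ℂ)) Complex.ofReal_zero)
      (Complex.ofRealCLM.contDiff.comp hφ)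
    have hψ : ∀ x, ψ x = φ x := fun x => rfl
    have h1 := congrArg (fun T : 𝓢'(ℝ, ℂ) => T ψ) (Lp.fourier_toTemperedDistribution_eq (hf2.toLp f))
    simp only [TemperedDistribution.fourier_apply, Lp.toTemperedDistribution_apply] at h1
    have h2 : ∫ x, (𝓕 ψ) x • (hf2.toLp f) x = ∫ x, (𝓕 (ψ : ℝ → ℂ)) x • f x := by
      refine integral_congr_ae ?_
      filter_upwards [hf2.coeFn_toLp] with x hx
      rw [hx, SchwartzMap.fourier_coe]
    have h3 : ∫ x, (𝓕 (ψ : ℝ → ℂ)) x • f x = ∫ x, (ψ : ℝ → ℂ) x • 𝓕 f x := by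
      have := VectorFourier.integral_fourierIntegral_smul_eq_flip (𝕜 := ℝ) (V := ℝ) (W := ℝ)
        (L := innerₗ ℝ) (e := Real.fourierChar) (μ := volume) (ν := volume)
        (f := (ψ : ℝ → ℂ)) (g := f) Real.continuous_fourierChar (innerSL ℝ).continuous₂
        ψ.integrable hf
      rw [flip_innerₗ] at this
      exact this
    have h4 : ∫ x, φ x • (G x - 𝓕 f x : ℂ) = (∫ x, ψ x • G x) - ∫ x, ψ x • 𝓕 f x := by
      rw [← integral_sub]
      · refine integral_congr_ae (ae_of_all _ fun x => ?_)
        simp only [hψ, smul_eq_mul, Complex.real_smul]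
        ring
      · exact hGl.integrable_smul_left_of_hasCompactSupport ψ.continuous
          (hφc.comp_left (g := ((↑) : ℝ → ℂ)) Complex.ofReal_zero)
      · exact hc.locallyIntegrable.integrable_smul_left_of_hasCompactSupport ψ.continuous
          (hφc.comp_left (g := ((↑) : ℝ → ℂ)) Complex.ofReal_zero)
    rw [h4, ← h3, ← h2, h1, sub_self]
  filter_upwards [key] with x hx
  exact sub_eq_zero.1 hx

theorem lintegral_enorm_sq_fourier {f : ℝ → ℂ} (hf : Integrable f) (hf2 : MemLp f 2) :
    ∫⁻ x, ‖𝓕 f x‖ₑ ^ 2 = ∫⁻ x, ‖f x‖ₑ ^ 2 := by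
  have h : eLpNorm (𝓕 f) 2 volume = eLpNorm f 2 volume := by
    rw [← eLpNorm_congr_ae (fourier_toLp_ae_eq hf hf2), ← eLpNorm_congr_ae hf2.coeFn_toLp,
      ← Lp.enorm_def, ← Lp.enorm_def, ← ofReal_norm, ← ofReal_norm, Lp.norm_fourier_eq]
  simp only [eLpNorm_eq_lintegral_rpow_enorm_toReal (p := 2) (by norm_num) (by norm_num)] at h
  have := congrArg (fun x : ℝ≥0∞ => x ^ (2 : ℝ)) h
  simp only [← ENNReal.rpow_mul] at this
  simpa using this

theorem lintegral_comp_div_const (f : ℝ → ℝ≥0∞) {a : ℝ} (ha : 0 < a) :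
    ∫⁻ x, f (x / a) = ENNReal.ofReal a * ∫⁻ x, f x := by
  have e : MeasurableEmbedding fun x : ℝ => x / a :=
    (Homeomorph.mulRight₀ a⁻¹ (inv_ne_zero ha.ne')).measurableEmbedding
  have h := Real.map_volume_mul_right (a := a⁻¹) (inv_ne_zero ha.ne')
  rw [← e.lintegral_map]
  simp_rw [div_eq_mul_inv]
  rw [h, lintegral_smul_measure, inv_inv, abs_of_pos ha, smul_eq_mul]

/-- The kernel `e^{-i x ξ}` on `ℝ`. -/
theorem plancherelKernel_real :
    PlancherelKernel (volume : Measure ℝ) (volume : Measure ℝ)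
      (fun ξ x => Complex.exp (-Complex.I * ((x * ξ : ℝ) : ℂ))) (2 * NNReal.pi) where
  meas := by
    refine Continuous.measurable ?_
    simp only [Function.uncurry_def]
    fun_prop
  norm_le ξ x := by
    rw [neg_mul, ← mul_neg, ← Complex.ofReal_neg, mul_comm, Complex.norm_exp_ofReal_mul_I]
  plancherel f hf hf2 := by
    have h : ∀ ξ : ℝ, ∫ x, Complex.exp (-Complex.I * ((x * ξ : ℝ) : ℂ)) * f x
        = 𝓕 f (ξ / (2 * Real.pi)) := by
      intro ξ
      rw [Real.fourier_eq]
      refine integral_congr_ae (ae_of_all _ fun x => ?_)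
      simp only [Circle.smul_def, smul_eq_mul, Real.fourierChar_apply, RCLike.inner_apply,
        conj_trivial]
      congr 2
      have : (Real.pi : ℂ) ≠ 0 := by exact_mod_cast Real.pi_ne_zero
      push_cast
      field_simp
    simp_rw [h]
    rw [lintegral_comp_div_const (fun x => ‖𝓕 f x‖ₑ ^ 2) (by positivity),
      lintegral_enorm_sq_fourier hf hf2]
    congr 1
    rw [ENNReal.ofReal_mul (by norm_num), ENNReal.coe_mul]
    congr 1
    · simp
    · rw [← NNReal.coe_real_pi, ENNReal.ofReal_coe_nnreal]

theorem norm_fourier_apply {T : ℝ} (k : ℤ) (y : AddCircle T) : ‖(fourier k y : ℂ)‖ = 1 := by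
  rw [fourier_apply]
  exact Circle.norm_coe _

section Circle

variable {T : ℝ} [hT : Fact (0 < T)]

/-- The kernel `e^{-i k y}` on the circle. -/
theorem plancherelKernel_circle :
    PlancherelKernel (volume : Measure (AddCircle T)) (Measure.count : Measure ℤ)
      (fun k y => fourier (-k) y) T.toNNReal where
  meas := by
    refine measurable_from_prod_countable_right fun k => ?_
    exact (fourier (-k)).continuous.measurable
  norm_le k y := (norm_fourier_apply _ _).le
  plancherel f hf hf2 := by
    have hf2' : MemLp f 2 (AddCircle.haarAddCircle (T := T)) :=
      memLp_haarAddCircle_iff.2 hf2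
    have h1 := hasSum_sq_fourierCoeff (hf2'.toLp f)
    have h2 : ∀ k, fourierCoeff (hf2'.toLp f) k = fourierCoeff f k :=
      fun k => congrFun (fourierCoeff_congr_ae hf2'.coeFn_toLp) k
    -- `fourierCoeff` uses the Haar probability measure, so each Lebesgue integral carries a factor
    -- `T`. Squaring gives `T²`, and one `T` is absorbed in passing back to `volume`.
    have h3 : ∀ k : ℤ, ∫ y : AddCircle T, fourier (-k) y * f y = T * fourierCoeff f k := by
      intro k
      rw [fourierCoeff, AddCircle.integral_haarAddCircle, Complex.real_smul]
      have : (T : ℂ) ≠ 0 := by exact_mod_cast hT.out.ne'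
      push_cast
      simp only [smul_eq_mul]
      field_simp
    have h4 : ∫ t, ‖hf2'.toLp f t‖ ^ 2 ∂(AddCircle.haarAddCircle (T := T))
        = ∫ t, ‖f t‖ ^ 2 ∂(AddCircle.haarAddCircle (T := T)) := by
      refine integral_congr_ae ?_
      filter_upwards [hf2'.coeFn_toLp] with x hx
      rw [hx]
    simp_rw [h2, h4] at h1
    have h5 : ∑' k, ‖fourierCoeff f k‖ₑ ^ 2
        = ∫⁻ t, ‖f t‖ₑ ^ 2 ∂(AddCircle.haarAddCircle (T := T)) := by
      have e : ∀ z : ℂ, ‖z‖ₑ ^ 2 = ENNReal.ofReal (‖z‖ ^ 2) := fun z => by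
        rw [ENNReal.ofReal_pow (norm_nonneg _), ofReal_norm]
      simp_rw [e]
      rw [← ENNReal.ofReal_tsum_of_nonneg (fun _ => by positivity) h1.summable, h1.tsum_eq,
        ofReal_integral_eq_lintegral_ofReal _ (ae_of_all _ fun _ => by positivity)]
      exact (memLp_two_iff_integrable_sq_norm hf2'.1).1 hf2'
    rw [lintegral_count]
    simp_rw [h3, enorm_mul, mul_pow]
    rw [ENNReal.tsum_mul_left, h5, AddCircle.volume_eq_smul_haarAddCircle, lintegral_smul_measure]
    have e : ‖(T : ℂ)‖ₑ = ENNReal.ofReal T := by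
      rw [← ofReal_norm, Complex.norm_real, Real.norm_of_nonneg hT.out.le]
    rw [e, smul_eq_mul, sq, mul_assoc]
    rfl

/-- The kernel `e^{i k y}` of Fourier series on the circle. -/
theorem plancherelKernel_circle_adjoint :
    PlancherelKernel (Measure.count : Measure ℤ) (volume : Measure (AddCircle T))
      (fun y k => fourier k y) T.toNNReal where
  meas := by
    refine measurable_from_prod_countable_left fun k => ?_
    exact (fourier k).continuous.measurable
  norm_le k y := (norm_fourier_apply _ _).le
  plancherel f hf hf2 := by
    have hsm := integrable_count_iff.1 hf
    set S : AddCircle T → ℂ := fun y => ∫ k, fourier k y * f k ∂(Measure.count : Measure ℤ) with hS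
    have hSm : Measurable S := by
      refine (StronglyMeasurable.integral_prod_right
        (f := fun (y : AddCircle T) (k : ℤ) => fourier k y * f k) ?_).measurable
      refine (measurable_from_prod_countable_left fun k => ?_).stronglyMeasurable
      exact (fourier k).continuous.measurable.mul_const (f k)
    have hSb : ∀ y, ‖S y‖ ≤ ∫ k, ‖f k‖ ∂(Measure.count : Measure ℤ) := by
      intro y
      refine norm_integral_le_of_norm_le hf.norm (ae_of_all _ fun k => ?_)
      rw [norm_mul, norm_fourier_apply, one_mul]
    have hS2 : MemLp S 2 volume := MemLp.of_bound hSm.aestronglyMeasurable _ (ae_of_all _ hSb)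
    have hS1 : Integrable S volume := hS2.integrable (by norm_num)
    have hT0 : ENNReal.ofReal T ≠ 0 := by simpa using hT.out
    -- By orthogonality the Fourier integrals of the series `S` return its coefficients, so the
    -- identity for the forward kernel applied to `S` reads `T² ‖f‖² = T ‖S‖²`.
    have hcoef : ∀ j : ℤ, ∫ y, fourier (-j) y * S y = T * f j := by
      intro j
      have e1 : ∀ y : AddCircle T, fourier (-j) y * S y
          = ∫ k, fourier (k - j) y * f k ∂(Measure.count : Measure ℤ) := by
        intro y
        rw [hS, ← integral_const_mul]
        refine integral_congr_ae (ae_of_all _ fun k => ?_)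
        simp only
        rw [sub_eq_add_neg, _root_.fourier_add]
        ring
      simp_rw [e1]
      rw [integral_integral_swap]
      · have e2 : ∀ k : ℤ, ∫ y : AddCircle T, fourier (k - j) y * f k
            = if k = j then (T : ℂ) * f j else 0 := by
          intro k
          rw [integral_mul_const]
          have := fourierCoeff_fourier (T := T) (k - j)
          have h0 := congrFun this 0
          rw [fourierCoeff, AddCircle.integral_haarAddCircle] at h0
          simp only [neg_zero, _root_.fourier_zero, one_smul, Complex.real_smul] at h0
          have hTc : (T : ℂ) ≠ 0 := by exact_mod_cast hT.out.ne'
          split_ifs with hkj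
          · subst hkj
            have hv : volume.real (Set.univ : Set (AddCircle T)) = T := by
              rw [measureReal_def, AddCircle.measure_univ, ENNReal.toReal_ofReal hT.out.le]
            simp [hv]
          · rw [Pi.single_apply, if_neg (by omega)] at h0
            have : ∫ t : AddCircle T, (fourier (k - j) t : ℂ) = 0 := by
              rcases mul_eq_zero.1 h0 with h | h
              · exact absurd h (by simpa using hTc)
              · exact h
            rw [this, zero_mul]
        simp_rw [e2]
        rw [integral_countable]
        · rw [tsum_eq_single j]
          · simp
          · intro k hk
            simp [hk]
        · rw [integrable_count_iff]
          exact summable_of_ne_finset_zero (s := {j}) (fun k hk => by simp at hk; simp [hk])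
      · have hb : Integrable (fun p : AddCircle T × ℤ => f p.2)
            ((volume : Measure (AddCircle T)).prod Measure.count) := hf.comp_snd _
        refine hb.bdd_mul (c := 1) ?_ ?_
        · refine (measurable_from_prod_countable_left fun k => ?_).aestronglyMeasurable
          exact (fourier (k - j)).continuous.measurable
        · exact ae_of_all _ fun p => (norm_fourier_apply _ _).le
    have h := plancherelKernel_circle.plancherel S hS1 hS2
    simp_rw [hcoef, enorm_mul, mul_pow] at h
    rw [lintegral_const_mul' _ _ (by simp)] at h
    have e : ‖(T : ℂ)‖ₑ = ENNReal.ofReal T := by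
      rw [← ofReal_norm, Complex.norm_real, Real.norm_of_nonneg hT.out.le]
    rw [e, sq, mul_assoc] at h
    exact ((ENNReal.mul_right_inj hT0 (by simp)).1 h).symm

end Circle

/-! ### Extension of the kernel operators to `L²`, and adjoints -/

theorem enorm_sq_Lp {X : Type*} [MeasurableSpace X] {μ : Measure X} (u : Lp ℂ 2 μ) :
    ‖u‖ₑ ^ 2 = ∫⁻ x, ‖u x‖ₑ ^ 2 ∂μ := by
  rw [Lp.enorm_def, eLpNorm_eq_lintegral_rpow_enorm_toReal (by norm_num) (by norm_num)]
  rw [← ENNReal.rpow_natCast, ← ENNReal.rpow_mul]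
  simp

theorem enorm_sq_toLp {X : Type*} [MeasurableSpace X] {μ : Measure X} {f : X → ℂ}
    (hf : MemLp f 2 μ) : ‖hf.toLp f‖ₑ ^ 2 = ∫⁻ x, ‖f x‖ₑ ^ 2 ∂μ := by
  rw [enorm_sq_Lp]
  refine lintegral_congr_ae ?_
  filter_upwards [hf.coeFn_toLp] with x hx
  rw [hx]

/-- The integrable functions in `L²`. -/
def integrableLp {X : Type*} [MeasurableSpace X] (μ : Measure X) : Submodule ℂ (Lp ℂ 2 μ) where
  carrier := {f | Integrable f μ}
  zero_mem' := (integrable_zero _ _ _).congr (Lp.coeFn_zero _ _ _).symm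
  add_mem' {f g} hf hg := (Integrable.add hf hg).congr (Lp.coeFn_add f g).symm
  smul_mem' c f hf := (Integrable.smul c hf).congr (Lp.coeFn_smul c f).symm

theorem dense_integrableLp {X : Type*} [MeasurableSpace X] (μ : Measure X) :
    Dense (integrableLp μ : Set (Lp ℂ 2 μ)) := by
  refine (Lp.simpleFunc.dense (E := ℂ) (μ := μ) (p := 2) (by norm_num)).mono ?_
  rintro f ⟨s, hs⟩
  have h1 : (f : X → ℂ) =ᵐ[μ] s := by
    have := AEEqFun.coeFn_mk (μ := μ) s s.aestronglyMeasurable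
    rwa [hs] at this
  have h2 : MemLp s 2 μ := (Lp.memLp f).ae_eq h1
  exact ((SimpleFunc.memLp_iff_integrable (by norm_num) (by norm_num)).1 h2).congr h1.symm

namespace PlancherelKernel

variable {X Y : Type*} [MeasurableSpace X] [MeasurableSpace Y]
  {μ : Measure X} {ν : Measure Y} {κ : Y → X → ℂ} {c : ℝ≥0} [SFinite μ]

theorem memLp_integral (h : PlancherelKernel μ ν κ c) {f : X → ℂ} (hf : Integrable f μ)
    (hf2 : MemLp f 2 μ) : MemLp (fun y => ∫ x, κ y x * f x ∂μ) 2 ν := by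
  refine memLp_two_iff_lintegral.2 ⟨(h.aestronglyMeasurable_integral hf.1).aestronglyMeasurable, ?_⟩
  rw [h.plancherel f hf hf2]
  exact ENNReal.mul_lt_top (by simp) (memLp_two_iff_lintegral.1 hf2).2

/-- The integral operator on the integrable functions in `L²`. -/
noncomputable def denseMap (h : PlancherelKernel μ ν κ c) : integrableLp μ →ₗ[ℂ] Lp ℂ 2 ν where
  toFun f := (h.memLp_integral f.2 (Lp.memLp f.1)).toLp _
  map_add' f g := by
    rw [← MemLp.toLp_add]
    refine MemLp.toLp_congr _ _ (ae_of_all _ fun y => ?_)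
    simp only [Pi.add_apply]
    rw [← integral_add (h.integrable_mul f.2 y) (h.integrable_mul g.2 y)]
    refine integral_congr_ae ?_
    filter_upwards [Lp.coeFn_add f.1 g.1] with x hx
    rw [Submodule.coe_add, hx, Pi.add_apply, mul_add]
  map_smul' a f := by
    rw [RingHom.id_apply, ← MemLp.toLp_const_smul]
    refine MemLp.toLp_congr _ _ (ae_of_all _ fun y => ?_)
    simp only [Pi.smul_apply, smul_eq_mul]
    rw [← integral_const_mul]
    refine integral_congr_ae ?_
    filter_upwards [Lp.coeFn_smul a f.1] with x hx
    rw [Submodule.coe_smul, hx, Pi.smul_apply, smul_eq_mul]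
    ring

theorem norm_sq_of_enorm_sq {a b : ℝ} (ha : 0 ≤ a) (hb : 0 ≤ b)
    (h : ‖a‖ₑ ^ 2 = c * ‖b‖ₑ ^ 2) : a ^ 2 = c * b ^ 2 := by
  have := congrArg ENNReal.toReal h
  simpa [ENNReal.toReal_mul, ENNReal.toReal_pow, ha, hb, abs_of_nonneg] using this

theorem norm_denseMap_sq (h : PlancherelKernel μ ν κ c) (f : integrableLp μ) :
    ‖h.denseMap f‖ ^ 2 = c * ‖f.1‖ ^ 2 := by
  refine norm_sq_of_enorm_sq (norm_nonneg _) (norm_nonneg _) ?_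
  rw [enorm_norm, enorm_norm, enorm_sq_Lp f.1, ← h.plancherel _ f.2 (Lp.memLp f.1)]
  exact enorm_sq_toLp (h.memLp_integral f.2 (Lp.memLp f.1))

/-- The extension of the integral operator to `L²`. -/
noncomputable def l2Map (h : PlancherelKernel μ ν κ c) : Lp ℂ 2 μ →L[ℂ] Lp ℂ 2 ν :=
  h.denseMap.extendOfNorm (integrableLp μ).subtype

theorem l2Map_coe (h : PlancherelKernel μ ν κ c) (f : integrableLp μ) :
    h.l2Map f.1 = h.denseMap f := by
  -- `extendOfNorm` is a genuine extension only if the domain is dense and the map bounded; the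
  -- identity supplies the bound `√c`.
  refine LinearMap.extendOfNorm_eq (e := (integrableLp μ).subtype) ?_ ⟨√c, fun f => ?_⟩ f
  · simpa using (dense_integrableLp μ).denseRange_val
  · refine abs_le_of_sq_le_sq' ?_ (by positivity) |>.2
    rw [mul_pow, h.norm_denseMap_sq, Real.sq_sqrt (NNReal.coe_nonneg c)]
    rfl

theorem l2Map_toLp (h : PlancherelKernel μ ν κ c) {f : X → ℂ} (hf : Integrable f μ)
    (hf2 : MemLp f 2 μ) : h.l2Map (hf2.toLp f) =ᵐ[ν] fun y => ∫ x, κ y x * f x ∂μ := by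
  have hm : hf2.toLp f ∈ integrableLp μ := hf.congr hf2.coeFn_toLp.symm
  have := h.l2Map_coe ⟨_, hm⟩
  rw [this]
  refine (MemLp.coeFn_toLp (h.memLp_integral hm (Lp.memLp _))).trans (ae_of_all _ fun y => ?_)
  refine integral_congr_ae ?_
  filter_upwards [hf2.coeFn_toLp] with x hx
  rw [hx]

theorem norm_l2Map_sq (h : PlancherelKernel μ ν κ c) (u : Lp ℂ 2 μ) :
    ‖h.l2Map u‖ ^ 2 = c * ‖u‖ ^ 2 := by
  refine (dense_integrableLp μ).induction (fun f hf => ?_)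
    (isClosed_eq (by fun_prop) (by fun_prop)) u
  rw [h.l2Map_coe ⟨f, hf⟩, h.norm_denseMap_sq]

/-- The quadratic form of `T*T - c` vanishes by the norm identity, and over `ℂ` an operator with
vanishing quadratic form is zero. -/
theorem adjoint_l2Map_comp (h : PlancherelKernel μ ν κ c) (u : Lp ℂ 2 μ) :
    (h.l2Map).adjoint (h.l2Map u) = (c : ℂ) • u := by
  set T : Lp ℂ 2 μ →L[ℂ] Lp ℂ 2 μ :=
    h.l2Map.adjoint ∘L h.l2Map - (c : ℂ) • ContinuousLinearMap.id ℂ (Lp ℂ 2 μ) with hT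
  have hTu : ∀ u, T u = h.l2Map.adjoint (h.l2Map u) - (c : ℂ) • u := fun u => rfl
  have h0 := (inner_map_self_eq_zero (T : Lp ℂ 2 μ →ₗ[ℂ] Lp ℂ 2 μ)).1 fun u => by
    rw [ContinuousLinearMap.coe_coe, hTu, inner_sub_left, ContinuousLinearMap.adjoint_inner_left,
      inner_smul_left, inner_self_eq_norm_sq_to_K, inner_self_eq_norm_sq_to_K, sub_eq_zero]
    have e : ((‖h.l2Map u‖ ^ 2 : ℝ) : ℂ) = ((c * ‖u‖ ^ 2 : ℝ) : ℂ) := by rw [h.norm_l2Map_sq u]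
    push_cast at e
    simpa using e
  have h1 : T u = 0 := LinearMap.congr_fun h0 u
  rwa [hTu, sub_eq_zero] at h1

theorem inner_l2Map (h : PlancherelKernel μ ν κ c) (u v : Lp ℂ 2 μ) :
    inner ℂ (h.l2Map u) (h.l2Map v) = c * inner ℂ u v := by
  rw [← ContinuousLinearMap.adjoint_inner_right, h.adjoint_l2Map_comp, inner_smul_right]

variable [SFinite ν]

/-- For integrable functions this is Fubini with a bounded kernel; density in both arguments gives
the rest. -/
theorem l2Map_adjoint (h : PlancherelKernel μ ν κ c)
    (h' : PlancherelKernel ν μ (fun x y => starRingEnd ℂ (κ y x)) c) :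
    h'.l2Map = h.l2Map.adjoint := by
  rw [ContinuousLinearMap.eq_adjoint_iff]
  intro V u
  refine (dense_integrableLp ν).induction (P := fun V => inner ℂ (h'.l2Map V) u
    = inner ℂ V (h.l2Map u)) (fun V hV => ?_) (isClosed_eq (by fun_prop) (by fun_prop)) V
  refine (dense_integrableLp μ).induction (P := fun u => inner ℂ (h'.l2Map V) u
    = inner ℂ V (h.l2Map u)) (fun u hu => ?_) (isClosed_eq (by fun_prop) (by fun_prop)) u
  have e1 : h.l2Map u =ᵐ[ν] fun y => ∫ x, κ y x * u x ∂μ := by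
    have := h.l2Map_toLp hu (Lp.memLp u)
    rwa [Lp.toLp_coeFn] at this
  have e2 : h'.l2Map V =ᵐ[μ] fun x => ∫ y, starRingEnd ℂ (κ y x) * V y ∂ν := by
    have := h'.l2Map_toLp hV (Lp.memLp V)
    rwa [Lp.toLp_coeFn] at this
  rw [L2.inner_def, L2.inner_def]
  have f1 : ∫ x, inner ℂ (h'.l2Map V x) (u x) ∂μ
      = ∫ x, ∫ y, κ y x * (starRingEnd ℂ (V y) * u x) ∂ν ∂μ := by
    refine integral_congr_ae ?_
    filter_upwards [e2] with x hx
    rw [hx, RCLike.inner_apply, ← integral_conj, ← integral_const_mul]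
    refine integral_congr_ae (ae_of_all _ fun y => ?_)
    simp only [map_mul, RCLike.conj_conj]
    ring
  have f2 : ∫ y, inner ℂ (V y) (h.l2Map u y) ∂ν
      = ∫ y, ∫ x, κ y x * (starRingEnd ℂ (V y) * u x) ∂μ ∂ν := by
    refine integral_congr_ae ?_
    filter_upwards [e1] with y hy
    rw [hy, RCLike.inner_apply, ← integral_mul_const]
    refine integral_congr_ae (ae_of_all _ fun x => ?_)
    simp only
    ring
  rw [f1, f2, integral_integral_swap]
  have hV' : Integrable (fun y => starRingEnd ℂ (V y)) ν :=
    hV.norm.mono' (Complex.continuous_conj.comp_aestronglyMeasurable hV.1)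
      (ae_of_all _ fun x => by simp)
  have hi : Integrable (fun p : X × Y => u p.1 * starRingEnd ℂ (V p.2)) (μ.prod ν) :=
    Integrable.mul_prod hu hV'
  refine (hi.bdd_mul (c := 1) (f := fun p : X × Y => κ p.2 p.1) ?_ ?_).congr ?_
  · exact (h.meas.comp measurable_swap).aestronglyMeasurable
  · exact ae_of_all _ fun p => h.norm_le _ _
  · exact ae_of_all _ fun p => by simp only [Function.uncurry]; ring

/-- If the adjoint kernel satisfies Plancherel's identity as well, then the extension to `L²` is
inverted by the adjoint, up to the constant. -/
theorem l2Map_l2Map_adjoint (h : PlancherelKernel μ ν κ c)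
    (h' : PlancherelKernel ν μ (fun x y => starRingEnd ℂ (κ y x)) c) (V : Lp ℂ 2 ν) :
    h.l2Map (h'.l2Map V) = (c : ℂ) • V := by
  have e : h.l2Map = h'.l2Map.adjoint := by
    rw [l2Map_adjoint h h', ContinuousLinearMap.adjoint_adjoint]
  rw [e, h'.adjoint_l2Map_comp]

end PlancherelKernel

/-! ### The frequency measure and the space-time kernel -/

instance (lam : ℝ) : SFinite (freqMeasure lam) := by
  unfold freqMeasure
  infer_instance

instance (lam : ℝ) : SigmaFinite (freqMeasure lam) := by
  have : freqMeasure lam = (lam⁻¹).toNNReal •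
    (volume : Measure ℝ).prod ((Measure.count : Measure ℤ).prod (volume : Measure ℝ)) := rfl
  rw [this]
  infer_instance

instance (lam : ℝ) : (freqMeasure lam).IsAddLeftInvariant := by
  unfold freqMeasure
  infer_instance

theorem measurePreserving_neg_prod {G H : Type*} [MeasurableSpace G] [MeasurableSpace H]
    [Neg G] [Neg H] (μ : Measure G) (ν : Measure H) [SFinite μ] [SFinite ν]
    (hμ : MeasurePreserving (fun x => -x) μ μ) (hν : MeasurePreserving (fun x => -x) ν ν) :
    MeasurePreserving (fun x => -x) (μ.prod ν) (μ.prod ν) :=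
  hμ.prod hν

instance (lam : ℝ) : (freqMeasure lam).IsNegInvariant := by
  refine ⟨?_⟩
  have h1 : MeasurePreserving (fun x : ℝ => -x) volume volume := Measure.measurePreserving_neg _
  have h2 : MeasurePreserving (fun x : ℤ => -x) Measure.count Measure.count :=
    Measure.measurePreserving_neg _
  have h := measurePreserving_neg_prod _ _ h1 (measurePreserving_neg_prod _ _ h2 h1)
  unfold freqMeasure
  rw [Measure.neg, Measure.map_smul]
  exact congrArg _ h.map_eq

/-- The kernel `e^{-i (t τ + x ξ + y q)}` of the space-time Fourier transform. -/
noncomputable def cylKernel (lam : ℝ) (z : Freq) (p : Cyl lam) : ℂ :=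
  Complex.exp (-Complex.I * ((p.1 * z.1 : ℝ) : ℂ)) *
    (fourier (-z.2.1) p.2.1 * Complex.exp (-Complex.I * ((p.2.2 * z.2.2 : ℝ) : ℂ)))

/-- The constant `(2 π)³` in Plancherel's identity. -/
noncomputable def cylConst : ℝ≥0 := (2 * NNReal.pi) ^ 3

theorem cylConst_pos : 0 < cylConst := by
  unfold cylConst
  have := NNReal.pi_pos
  positivity

theorem lam_pos {lam : ℝ} (h : 0 < 2 * Real.pi * lam) : 0 < lam :=
  (mul_pos_iff_of_pos_left (by positivity)).1 h

/-- The box `|x| ≤ R`, `|t| ≤ R`. -/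
def box (lam R : ℝ) : Set (Cyl lam) := {p | |p.1| ≤ R ∧ |p.2.2| ≤ R}

theorem measurableSet_box {lam : ℝ} (R : ℝ) : MeasurableSet (box lam R) := by
  have h1 : Measurable fun p : Cyl lam => |p.1| := by fun_prop
  have h2 : Measurable fun p : Cyl lam => |p.2.2| := by fun_prop
  exact (measurableSet_le h1 measurable_const).inter (measurableSet_le h2 measurable_const)

/-! ### The `L²` Fourier transform on the cylinder: existence, uniqueness, inversion -/

section Transform

variable {lam : ℝ} [hlam : Fact (0 < 2 * Real.pi * lam)]

/-- The factors `2π`, `2πλ`, `2π` from the three variables and `1/λ` from the frequency measure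
multiply to `(2π)³`, which is independent of the period. -/
theorem plancherelKernel_cyl :
    PlancherelKernel (volume : Measure (Cyl lam)) (freqMeasure lam) (cylKernel lam) cylConst := by
  have h := plancherelKernel_real.prod
    ((plancherelKernel_circle (T := 2 * Real.pi * lam)).prod plancherelKernel_real)
  have h2 := h.smul_right (lam⁻¹).toNNReal
  have hl := lam_pos hlam.out
  have e : (lam⁻¹).toNNReal * (2 * NNReal.pi * ((2 * Real.pi * lam).toNNReal * (2 * NNReal.pi)))
      = cylConst := by
    apply NNReal.coe_injective
    simp only [NNReal.coe_mul, cylConst, NNReal.coe_pow, NNReal.coe_real_pi,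
      Real.coe_toNNReal _ hlam.out.le, Real.coe_toNNReal _ (inv_pos.2 hl).le, NNReal.coe_ofNat]
    field_simp
  rw [e] at h2
  exact h2

/-- An isometry up to a constant need not be onto. The Plancherel identity for the conjugate kernel
is what makes the transform invertible. -/
theorem plancherelKernel_cyl_adjoint :
    PlancherelKernel (freqMeasure lam) (volume : Measure (Cyl lam))
      (fun p z => starRingEnd ℂ (cylKernel lam z p)) cylConst := by
  have h0 : PlancherelKernel (volume : Measure ℝ) (volume : Measure ℝ)
      (fun x ξ => starRingEnd ℂ (Complex.exp (-Complex.I * ((x * ξ : ℝ) : ℂ)))) (2 * NNReal.pi) := by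
    have := plancherelKernel_real.star
    simp_rw [mul_comm] at this ⊢
    exact this
  have h := h0.prod ((plancherelKernel_circle_adjoint (T := 2 * Real.pi * lam)).prod h0)
  have hl := lam_pos hlam.out
  have h2 := h.smul_left (lam⁻¹).toNNReal (by simpa using hl)
  have e : (lam⁻¹).toNNReal * (2 * NNReal.pi * ((2 * Real.pi * lam).toNNReal * (2 * NNReal.pi)))
      = cylConst := by
    apply NNReal.coe_injective
    simp only [NNReal.coe_mul, cylConst, NNReal.coe_pow, NNReal.coe_real_pi,
      Real.coe_toNNReal _ hlam.out.le, Real.coe_toNNReal _ (inv_pos.2 hl).le, NNReal.coe_ofNat]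
    field_simp
  rw [e] at h2
  have e2 : (fun (p : Cyl lam) (z : Freq) => starRingEnd ℂ (cylKernel lam z p)) =
      fun (p : Cyl lam) (z : Freq) =>
        starRingEnd ℂ (Complex.exp (-Complex.I * ((p.1 * z.1 : ℝ) : ℂ))) *
        (fourier z.2.1 p.2.1 *
          starRingEnd ℂ (Complex.exp (-Complex.I * ((p.2.2 * z.2.2 : ℝ) : ℂ)))) := by
    funext p z
    simp only [cylKernel, map_mul, ← fourier_neg, neg_neg]
  rw [e2]
  exact h2

theorem volume_box_lt_top (R : ℝ) : (volume : Measure (Cyl lam)) (box lam R) < ⊤ := by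
  have : box lam R ⊆ Set.Icc (-R) R ×ˢ (Set.univ ×ˢ Set.Icc (-R) R) := by
    rintro p ⟨h1, h2⟩
    exact ⟨abs_le.1 h1, trivial, abs_le.1 h2⟩
  refine (measure_mono this).trans_lt ?_
  rw [Measure.volume_eq_prod, Measure.prod_prod, Measure.volume_eq_prod, Measure.prod_prod]
  simp only [Real.volume_Icc, AddCircle.measure_univ]
  finiteness

theorem integrable_indicator_box {u : Cyl lam → ℂ} (hu : MemLp u 2 volume) (R : ℝ) :
    Integrable ((box lam R).indicator u) volume := by
  rw [integrable_indicator_iff (measurableSet_box R)]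
  have : IsFiniteMeasure ((volume : Measure (Cyl lam)).restrict (box lam R)) :=
    ⟨by simpa using volume_box_lt_top R⟩
  exact (hu.restrict _).integrable (by norm_num)

theorem memLp_indicator_box {u : Cyl lam → ℂ} (hu : MemLp u 2 volume) (R : ℝ) :
    MemLp ((box lam R).indicator u) 2 volume := hu.indicator (measurableSet_box R)

theorem truncFourier_eq (u : Cyl lam → ℂ) (R : ℝ) (z : Freq) :
    truncFourier u R z = ∫ p, cylKernel lam z p * (box lam R).indicator u p := by
  change ∫ p in box lam R, Complex.exp (-Complex.I * ((p.2.2 * z.2.2 + p.1 * z.1 : ℝ) : ℂ)) *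
      fourier (-z.2.1) p.2.1 * u p = _
  rw [← integral_indicator (measurableSet_box R)]
  refine integral_congr_ae (ae_of_all _ fun p => ?_)
  by_cases hp : p ∈ box lam R
  · simp only [Set.indicator_of_mem hp]
    rw [cylKernel]
    push_cast
    rw [mul_add, Complex.exp_add]
    ring
  · simp [hp]

theorem tendsto_eLpNorm_indicator_box {u : Cyl lam → ℂ} (hu : MemLp u 2 volume) :
    Tendsto (fun R => eLpNorm ((box lam R).indicator u - u) 2 volume) atTop (𝓝 0) := by
  have e : ∀ R, eLpNorm ((box lam R).indicator u - u) 2 volume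
      = (∫⁻ p, ‖((box lam R).indicator u - u) p‖ₑ ^ 2) ^ (1 / 2 : ℝ) := fun R => by
    rw [eLpNorm_eq_lintegral_rpow_enorm_toReal (by norm_num) (by norm_num)]
    simp
  simp_rw [e]
  have h : Tendsto (fun R => ∫⁻ p, ‖((box lam R).indicator u - u) p‖ₑ ^ 2) atTop
      (𝓝 (∫⁻ _ : Cyl lam, 0)) := by
    refine tendsto_lintegral_filter_of_dominated_convergence' (fun p => ‖u p‖ₑ ^ 2) ?_ ?_ ?_ ?_
    · exact Eventually.of_forall fun R =>
        ((hu.1.indicator (measurableSet_box R)).sub hu.1).enorm.pow_const 2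
    · refine Eventually.of_forall fun R => ae_of_all _ fun p => ?_
      by_cases hp : p ∈ box lam R <;> simp [hp]
    · exact (memLp_two_iff_lintegral.1 hu).2.ne
    · refine ae_of_all _ fun p => tendsto_const_nhds.congr' ?_
      filter_upwards [eventually_ge_atTop (max |p.1| |p.2.2|)] with R hR
      have : p ∈ box lam R := ⟨(le_max_left _ _).trans hR, (le_max_right _ _).trans hR⟩
      simp [this]
  have := h.ennrpow_const (1 / 2 : ℝ)
  simpa using this

/-- Cutting off to boxes converges in `L²`, and on each cut-off the continuous extension is the
truncated Fourier integral. This makes the choice in `fourierL2` meaningful. -/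
theorem isFourier_l2Map {u : Cyl lam → ℂ} (hu : MemLp u 2 volume) :
    IsFourier u (plancherelKernel_cyl.l2Map (hu.toLp u)) := by
  refine ⟨Lp.memLp _, ?_⟩
  have h1 : Tendsto (fun R => (memLp_indicator_box hu R).toLp _) atTop (𝓝 (hu.toLp u)) := by
    rw [Lp.tendsto_Lp_iff_tendsto_eLpNorm'']
    exact tendsto_eLpNorm_indicator_box hu
  have h2 := (plancherelKernel_cyl.l2Map.continuous.tendsto _).comp h1
  rw [Lp.tendsto_Lp_iff_tendsto_eLpNorm'] at h2
  refine h2.congr fun R => eLpNorm_congr_ae ?_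
  filter_upwards [plancherelKernel_cyl.l2Map_toLp (integrable_indicator_box hu R)
    (memLp_indicator_box hu R)] with z hz
  simp only [Function.comp, Pi.sub_apply]
  rw [hz, truncFourier_eq]

/-- Two `L²` limits of the same truncated integrals agree. Later transforms are identified by
verifying `IsFourier` or by an `L²` limit. -/
theorem IsFourier.ae_eq {u : Cyl lam → ℂ} {U V : Freq → ℂ} (hu : AEStronglyMeasurable u volume)
    (hU : IsFourier u U) (hV : IsFourier u V) : U =ᵐ[freqMeasure lam] V := by
  have hm : ∀ R, AEStronglyMeasurable (truncFourier u R) (freqMeasure lam) := by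
    intro R
    have : truncFourier u R = fun z => ∫ p, cylKernel lam z p * (box lam R).indicator u p :=
      funext fun z => truncFourier_eq u R z
    rw [this]
    exact (plancherelKernel_cyl.aestronglyMeasurable_integral
      (hu.indicator (measurableSet_box R))).aestronglyMeasurable
  have h0 : eLpNorm (U - V) 2 (freqMeasure lam) ≤ 0 := by
    have ht := hU.2.add hV.2
    rw [add_zero] at ht
    refine ge_of_tendsto' ht fun R => ?_
    have e : U - V = (fun z => truncFourier u R z - V z) - (fun z => truncFourier u R z - U z) := by
      funext z
      simp
    rw [e, add_comm]
    exact eLpNorm_sub_le ((hm R).sub hV.1.1) ((hm R).sub hU.1.1) (by norm_num)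
  have h1 := (eLpNorm_eq_zero_iff (hU.1.1.sub hV.1.1) (by norm_num)).1 (le_antisymm h0 bot_le)
  filter_upwards [h1] with z hz
  exact sub_eq_zero.1 hz

theorem isFourier_fourierL2 {u : Cyl lam → ℂ} (hu : MemLp u 2 volume) :
    IsFourier u (fourierL2 u) :=
  Classical.epsilon_spec (p := IsFourier u) ⟨_, isFourier_l2Map hu⟩

theorem memLp_fourierL2 {u : Cyl lam → ℂ} (hu : MemLp u 2 volume) :
    MemLp (fourierL2 u) 2 (freqMeasure lam) := (isFourier_fourierL2 hu).1

theorem IsFourier.fourierL2_ae_eq {u : Cyl lam → ℂ} {U : Freq → ℂ} (hu : MemLp u 2 volume)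
    (hU : IsFourier u U) : fourierL2 u =ᵐ[freqMeasure lam] U :=
  (isFourier_fourierL2 hu).ae_eq hu.1 hU

theorem l2Map_ae_eq {u : Cyl lam → ℂ} (hu : MemLp u 2 volume) :
    fourierL2 u =ᵐ[freqMeasure lam] plancherelKernel_cyl.l2Map (hu.toLp u) :=
  (isFourier_l2Map hu).fourierL2_ae_eq hu

theorem toLp_fourierL2 {u : Cyl lam → ℂ} (hu : MemLp u 2 volume) :
    (memLp_fourierL2 hu).toLp _ = plancherelKernel_cyl.l2Map (hu.toLp u) := by
  apply Lp.ext
  exact (MemLp.coeFn_toLp _).trans (l2Map_ae_eq hu)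

theorem fourierL2_sub {u v : Cyl lam → ℂ} (hu : MemLp u 2 volume) (hv : MemLp v 2 volume) :
    fourierL2 (fun p => u p - v p) =ᵐ[freqMeasure lam] fun z => fourierL2 u z - fourierL2 v z := by
  refine (l2Map_ae_eq (hu.sub hv)).trans ?_
  rw [MemLp.toLp_sub hu hv, map_sub]
  filter_upwards [Lp.coeFn_sub (plancherelKernel_cyl.l2Map (hu.toLp u))
    (plancherelKernel_cyl.l2Map (hv.toLp v)), l2Map_ae_eq hu, l2Map_ae_eq hv] with z h1 h2 h3
  rw [h1, h2, h3, Pi.sub_apply]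

theorem fourierL2_const_mul (a : ℂ) {u : Cyl lam → ℂ} (hu : MemLp u 2 volume) :
    fourierL2 (fun p => a * u p) =ᵐ[freqMeasure lam] fun z => a * fourierL2 u z := by
  refine (l2Map_ae_eq (hu.const_smul a)).trans ?_
  rw [MemLp.toLp_const_smul a hu, map_smul]
  filter_upwards [Lp.coeFn_smul a (plancherelKernel_cyl.l2Map (hu.toLp u)),
    l2Map_ae_eq hu] with z h1 h2
  rw [h1, h2, Pi.smul_apply, smul_eq_mul]

theorem fourierL2_of_integrable {u : Cyl lam → ℂ} (hu1 : Integrable u volume)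
    (hu : MemLp u 2 volume) :
    fourierL2 u =ᵐ[freqMeasure lam] fun z => ∫ p, cylKernel lam z p * u p :=
  (l2Map_ae_eq hu).trans (plancherelKernel_cyl.l2Map_toLp hu1 hu)

theorem fourierL2_of_tendsto {u : ℕ → Cyl lam → ℂ} {v : Cyl lam → ℂ} {V : Freq → ℂ}
    (hu : ∀ n, MemLp (u n) 2 volume) (hv : MemLp v 2 volume) (hV : MemLp V 2 (freqMeasure lam))
    (h : Tendsto (fun n => eLpNorm (u n - v) 2 volume) atTop (𝓝 0))
    (h' : Tendsto (fun n => eLpNorm (fourierL2 (u n) - V) 2 (freqMeasure lam)) atTop (𝓝 0)) :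
    fourierL2 v =ᵐ[freqMeasure lam] V := by
  have h1 : Tendsto (fun n => (hu n).toLp _) atTop (𝓝 (hv.toLp v)) := by
    rw [Lp.tendsto_Lp_iff_tendsto_eLpNorm'']
    exact h
  have h2 := (plancherelKernel_cyl.l2Map.continuous.tendsto _).comp h1
  have h3 : Tendsto (fun n => (memLp_fourierL2 (hu n)).toLp _) atTop (𝓝 (hV.toLp V)) := by
    rw [Lp.tendsto_Lp_iff_tendsto_eLpNorm'']
    exact h'
  have h4 := tendsto_nhds_unique h2 (h3.congr fun n => toLp_fourierL2 (hu n))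
  refine (l2Map_ae_eq hv).trans ?_
  rw [h4]
  exact hV.coeFn_toLp

theorem exists_fourierL2_eq {U : Freq → ℂ} (hU : MemLp U 2 (freqMeasure lam)) :
    ∃ u : Cyl lam → ℂ, MemLp u 2 volume ∧ fourierL2 u =ᵐ[freqMeasure lam] U := by
  have h := (plancherelKernel_cyl (lam := lam)).l2Map_l2Map_adjoint plancherelKernel_cyl_adjoint
  set w := (cylConst : ℂ)⁻¹ • plancherelKernel_cyl_adjoint.l2Map (hU.toLp U) with hw
  refine ⟨w, Lp.memLp w, (l2Map_ae_eq (Lp.memLp w)).trans ?_⟩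
  have hc : ((cylConst : ℝ≥0) : ℂ) ≠ 0 := by exact_mod_cast cylConst_pos.ne'
  rw [Lp.toLp_coeFn, hw, map_smul, h, smul_smul, inv_mul_cancel₀ hc, one_smul]
  exact hU.coeFn_toLp

/-- For an integrable transform the inverse is an explicit integral, hence a bounded function; this
boundedness is used in the product rule. -/
theorem fourierL2_inverse {U : Freq → ℂ} (hU1 : Integrable U (freqMeasure lam))
    (hU : MemLp U 2 (freqMeasure lam)) :
    MemLp (fun p => (cylConst : ℂ)⁻¹ * ∫ z, starRingEnd ℂ (cylKernel lam z p) * U z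
      ∂(freqMeasure lam)) 2 volume ∧
    fourierL2 (fun p => (cylConst : ℂ)⁻¹ * ∫ z, starRingEnd ℂ (cylKernel lam z p) * U z
      ∂(freqMeasure lam)) =ᵐ[freqMeasure lam] U := by
  have h := (plancherelKernel_cyl (lam := lam)).l2Map_l2Map_adjoint plancherelKernel_cyl_adjoint
  have hm := plancherelKernel_cyl_adjoint.memLp_integral hU1 hU
  have e : hm.toLp _ = plancherelKernel_cyl_adjoint.l2Map (hU.toLp U) := by
    apply Lp.ext
    exact (MemLp.coeFn_toLp hm).trans (plancherelKernel_cyl_adjoint.l2Map_toLp hU1 hU).symm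
  refine ⟨hm.const_mul _, (fourierL2_const_mul _ hm).trans ?_⟩
  have hc : ((cylConst : ℝ≥0) : ℂ) ≠ 0 := by exact_mod_cast cylConst_pos.ne'
  have h1 := l2Map_ae_eq hm
  rw [e, h] at h1
  filter_upwards [h1, Lp.coeFn_smul (cylConst : ℂ) (hU.toLp U), hU.coeFn_toLp] with z hz hz2 hz3
  rw [hz, hz2, Pi.smul_apply, hz3, smul_eq_mul, inv_mul_cancel_left₀ hc]

end Transform

/-! ### Parseval's identity and the convolution theorem -/

theorem memLp_conj {X : Type*} [MeasurableSpace X] {μ : Measure X} {u : X → ℂ}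
    (hu : MemLp u 2 μ) : MemLp (fun x => starRingEnd ℂ (u x)) 2 μ :=
  hu.of_le (Complex.continuous_conj.comp_aestronglyMeasurable hu.1) (ae_of_all _ fun x => by simp)

theorem conj_cylKernel {lam : ℝ} (z : Freq) (p : Cyl lam) :
    starRingEnd ℂ (cylKernel lam z p) = cylKernel lam (-z) p := by
  simp only [cylKernel, map_mul, ← fourier_neg, neg_neg, ← Complex.exp_conj, map_neg,
    Complex.conj_I, Complex.conj_ofReal, Prod.fst_neg, Prod.snd_neg, mul_neg, neg_mul,
    Complex.ofReal_neg]

theorem cylKernel_mul_cylKernel {lam : ℝ} (z η : Freq) (p : Cyl lam) :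
    cylKernel lam z p * cylKernel lam η p = cylKernel lam (z + η) p := by
  simp only [cylKernel, Prod.fst_add, Prod.snd_add, neg_add, fourier_add]
  push_cast
  simp only [mul_add, Complex.exp_add]
  ring

theorem measurePreserving_sub_left_freq {lam : ℝ} (z : Freq) :
    MeasurePreserving (fun w => z - w) (freqMeasure lam) (freqMeasure lam) :=
  Measure.measurePreserving_sub_left (freqMeasure lam) z

theorem integral_convolution_congr {lam : ℝ} {U V U' V' : Freq → ℂ} (hU : U =ᵐ[freqMeasure lam] U')
    (hV : V =ᵐ[freqMeasure lam] V') (z : Freq) :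
    ∫ w, U w * V (z - w) ∂(freqMeasure lam) = ∫ w, U' w * V' (z - w) ∂(freqMeasure lam) := by
  refine integral_congr_ae ?_
  have h := (measurePreserving_sub_left_freq (lam := lam) z).quasiMeasurePreserving.ae_eq_comp hV
  filter_upwards [hU, h] with w h1 h2
  simp only [Function.comp] at h2
  rw [h1, h2]

theorem tendsto_eLpNorm_two_of_dominated {X : Type*} [MeasurableSpace X] {μ : Measure X}
    {F : ℕ → X → ℂ} (G : X → ℝ≥0∞) (hF : ∀ n, AEStronglyMeasurable (F n) μ)
    (hG : ∫⁻ x, G x ^ 2 ∂μ ≠ ⊤) (hb : ∀ n, ∀ᵐ x ∂μ, ‖F n x‖ₑ ≤ G x)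
    (hl : ∀ᵐ x ∂μ, Tendsto (fun n => F n x) atTop (𝓝 0)) :
    Tendsto (fun n => eLpNorm (F n) 2 μ) atTop (𝓝 0) := by
  have e : ∀ n, eLpNorm (F n) 2 μ = (∫⁻ p, ‖F n p‖ₑ ^ 2 ∂μ) ^ (1 / 2 : ℝ) := fun n => by
    rw [eLpNorm_eq_lintegral_rpow_enorm_toReal (by norm_num) (by norm_num)]
    simp
  simp_rw [e]
  have h : Tendsto (fun n => ∫⁻ p, ‖F n p‖ₑ ^ 2 ∂μ) atTop (𝓝 (∫⁻ _ : X, 0 ∂μ)) := by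
    refine tendsto_lintegral_of_dominated_convergence' (fun x => G x ^ 2)
      (fun n => (hF n).enorm.pow_const 2) (fun n => ?_) hG ?_
    · filter_upwards [hb n] with x hx
      gcongr
    · filter_upwards [hl] with x hx
      have := (ENNReal.continuous_pow 2).tendsto _ |>.comp hx.enorm
      simpa [Function.comp_def] using this
  have := h.ennrpow_const (1 / 2 : ℝ)
  simpa using this

section Transform

variable {lam : ℝ} [hlam : Fact (0 < 2 * Real.pi * lam)]

theorem integral_conj_mul_eq {u v : Cyl lam → ℂ} (hu : MemLp u 2 volume) (hv : MemLp v 2 volume) :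
    ∫ p, starRingEnd ℂ (u p) * v p = (cylConst : ℂ)⁻¹ *
      ∫ z, starRingEnd ℂ (fourierL2 u z) * fourierL2 v z ∂(freqMeasure lam) := by
  have h := (plancherelKernel_cyl (lam := lam)).inner_l2Map (hu.toLp u) (hv.toLp v)
  rw [L2.inner_def, L2.inner_def] at h
  have e1 : ∫ p, inner ℂ (hu.toLp u p) (hv.toLp v p) = ∫ p, starRingEnd ℂ (u p) * v p := by
    refine integral_congr_ae ?_
    filter_upwards [hu.coeFn_toLp, hv.coeFn_toLp] with p h1 h2
    rw [h1, h2, RCLike.inner_apply, mul_comm]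
  have e2 : ∫ z, inner ℂ (plancherelKernel_cyl.l2Map (hu.toLp u) z)
      (plancherelKernel_cyl.l2Map (hv.toLp v) z) ∂(freqMeasure lam)
      = ∫ z, starRingEnd ℂ (fourierL2 u z) * fourierL2 v z ∂(freqMeasure lam) := by
    refine integral_congr_ae ?_
    filter_upwards [l2Map_ae_eq hu, l2Map_ae_eq hv] with p h1 h2
    rw [h1, h2, RCLike.inner_apply, mul_comm]
  have hc : ((cylConst : ℝ≥0) : ℂ) ≠ 0 := by exact_mod_cast cylConst_pos.ne'
  rw [e1, e2] at h
  rw [h, inv_mul_cancel_left₀]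
  exact hc

theorem eLpNorm_fourierL2 {u : Cyl lam → ℂ} (hu : MemLp u 2 volume) :
    eLpNorm (fourierL2 u) 2 (freqMeasure lam)
      = ENNReal.ofReal √cylConst * eLpNorm u 2 volume := by
  rw [eLpNorm_congr_ae (l2Map_ae_eq hu), ← Lp.enorm_def, ← eLpNorm_congr_ae hu.coeFn_toLp,
    ← Lp.enorm_def, ← ofReal_norm, ← ofReal_norm, ← ENNReal.ofReal_mul (by positivity)]
  congr 1
  have h := plancherelKernel_cyl.norm_l2Map_sq (hu.toLp u)
  rw [← Real.sqrt_sq (norm_nonneg (plancherelKernel_cyl.l2Map (hu.toLp u))), h,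
    Real.sqrt_mul (by positivity), Real.sqrt_sq (norm_nonneg _)]

theorem tendsto_eLpNorm_of_fourierL2 {u : ℕ → Cyl lam → ℂ} {v : Cyl lam → ℂ}
    (hu : ∀ n, MemLp (u n) 2 volume) (hv : MemLp v 2 volume)
    (h : Tendsto (fun n => eLpNorm (fourierL2 (u n) - fourierL2 v) 2 (freqMeasure lam))
      atTop (𝓝 0)) :
    Tendsto (fun n => eLpNorm (u n - v) 2 volume) atTop (𝓝 0) := by
  have hc : 0 < √(cylConst : ℝ) := Real.sqrt_pos.2 (by exact_mod_cast cylConst_pos)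
  have e : ∀ n, eLpNorm (u n - v) 2 volume = (ENNReal.ofReal √cylConst)⁻¹ *
      eLpNorm (fourierL2 (u n) - fourierL2 v) 2 (freqMeasure lam) := by
    intro n
    have h1 := eLpNorm_fourierL2 ((hu n).sub hv)
    have h2 : eLpNorm (fourierL2 (u n - v)) 2 (freqMeasure lam)
        = eLpNorm (fourierL2 (u n) - fourierL2 v) 2 (freqMeasure lam) :=
      eLpNorm_congr_ae (fourierL2_sub (hu n) hv)
    rw [← h2, h1, ← mul_assoc, ENNReal.inv_mul_cancel (by simpa using hc) (by simp), one_mul]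
  simp_rw [e]
  have h3 := ENNReal.Tendsto.const_mul (a := (ENNReal.ofReal √cylConst)⁻¹) h
    (Or.inr (ENNReal.inv_ne_top.2 (by simpa using hc)))
  simpa using h3

theorem norm_cylKernel_le (z : Freq) (p : Cyl lam) : ‖cylKernel lam z p‖ ≤ 1 :=
  plancherelKernel_cyl.norm_le z p

theorem measurable_cylKernel (z : Freq) : Measurable (cylKernel lam z) :=
  plancherelKernel_cyl.meas_left z

theorem fourierL2_conj {u : Cyl lam → ℂ} (hu : MemLp u 2 volume) :
    fourierL2 (fun p => starRingEnd ℂ (u p)) =ᵐ[freqMeasure lam]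
      fun z => starRingEnd ℂ (fourierL2 u (-z)) := by
  have hn := Measure.measurePreserving_neg (freqMeasure lam)
  have hF := isFourier_fourierL2 hu
  refine IsFourier.fourierL2_ae_eq (memLp_conj hu)
    ⟨memLp_conj (hF.1.comp_measurePreserving hn), ?_⟩
  refine hF.2.congr fun R => ?_
  have e : ∀ z, truncFourier (fun p => starRingEnd ℂ (u p)) R z
      = starRingEnd ℂ (truncFourier u R (-z)) := by
    intro z
    rw [truncFourier_eq, truncFourier_eq, ← integral_conj]
    refine integral_congr_ae (ae_of_all _ fun p => ?_)
    simp only [map_mul, conj_cylKernel, neg_neg]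
    by_cases hp : p ∈ box lam R <;> simp [hp]
  have hm : ∀ R, AEStronglyMeasurable (truncFourier u R) (freqMeasure lam) := by
    intro R
    have : truncFourier u R = fun z => ∫ p, cylKernel lam z p * (box lam R).indicator u p :=
      funext fun z => truncFourier_eq u R z
    rw [this]
    exact (plancherelKernel_cyl.aestronglyMeasurable_integral
      (hu.1.indicator (measurableSet_box R))).aestronglyMeasurable
  refine (eLpNorm_comp_measurePreserving ((hm R).sub hF.1.1) hn).symm.trans ?_
  refine eLpNorm_congr_norm_ae (ae_of_all _ fun z => ?_)
  simp only [Function.comp, Pi.sub_apply, e]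
  rw [← map_sub, RCLike.norm_conj]

/-- The bilinear form of Parseval's identity. -/
theorem integral_mul_eq {u v : Cyl lam → ℂ} (hu : MemLp u 2 volume) (hv : MemLp v 2 volume) :
    ∫ p, u p * v p = (cylConst : ℂ)⁻¹ *
      ∫ z, fourierL2 u (-z) * fourierL2 v z ∂(freqMeasure lam) := by
  have h := integral_conj_mul_eq (memLp_conj hu) hv
  simp only [RCLike.conj_conj] at h
  rw [h]
  congr 1
  refine integral_congr_ae ?_
  filter_upwards [fourierL2_conj hu] with z hz
  rw [hz, RCLike.conj_conj]

theorem memLp_cylKernel_mul {u : Cyl lam → ℂ} (hu : MemLp u 2 volume) (η : Freq) :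
    MemLp (fun p => cylKernel lam η p * u p) 2 volume := by
  refine hu.of_le ((measurable_cylKernel η).aestronglyMeasurable.mul hu.1) (ae_of_all _ fun p => ?_)
  rw [norm_mul]
  exact mul_le_of_le_one_left (norm_nonneg _) (norm_cylKernel_le _ _)

theorem fourierL2_cylKernel_mul {u : Cyl lam → ℂ} (hu : MemLp u 2 volume) (η : Freq) :
    fourierL2 (fun p => cylKernel lam η p * u p) =ᵐ[freqMeasure lam]
      fun z => fourierL2 u (z + η) := by
  have hn := measurePreserving_add_right (freqMeasure lam) η
  have hF := isFourier_fourierL2 hu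
  refine IsFourier.fourierL2_ae_eq (memLp_cylKernel_mul hu η)
    ⟨hF.1.comp_measurePreserving hn, ?_⟩
  refine hF.2.congr fun R => ?_
  have e : ∀ z, truncFourier (fun p => cylKernel lam η p * u p) R z
      = truncFourier u R (z + η) := by
    intro z
    rw [truncFourier_eq, truncFourier_eq]
    refine integral_congr_ae (ae_of_all _ fun p => ?_)
    simp only [← cylKernel_mul_cylKernel]
    by_cases hp : p ∈ box lam R
    · simp only [hp, Set.indicator_of_mem]
      ring
    · simp [hp]
  have hm : ∀ R, AEStronglyMeasurable (truncFourier u R) (freqMeasure lam) := by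
    intro R
    have : truncFourier u R = fun z => ∫ p, cylKernel lam z p * (box lam R).indicator u p :=
      funext fun z => truncFourier_eq u R z
    rw [this]
    exact (plancherelKernel_cyl.aestronglyMeasurable_integral
      (hu.1.indicator (measurableSet_box R))).aestronglyMeasurable
  refine (eLpNorm_comp_measurePreserving ((hm R).sub hF.1.1) hn).symm.trans ?_
  refine eLpNorm_congr_norm_ae (ae_of_all _ fun z => ?_)
  simp only [Function.comp, Pi.sub_apply, e]

/-- The Fourier integral of a product is the convolution of the Fourier transforms. -/
theorem integral_cylKernel_mul_mul {u v : Cyl lam → ℂ} (hu : MemLp u 2 volume)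
    (hv : MemLp v 2 volume) (z : Freq) :
    ∫ p, cylKernel lam z p * (u p * v p) = (cylConst : ℂ)⁻¹ *
      ∫ w, fourierL2 u w * fourierL2 v (z - w) ∂(freqMeasure lam) := by
  have h := integral_mul_eq hu (memLp_cylKernel_mul hv z)
  have e : ∫ p, cylKernel lam z p * (u p * v p) = ∫ p, u p * (cylKernel lam z p * v p) := by
    congr 1
    funext p
    ring
  rw [e, h]
  congr 1
  rw [← integral_neg_eq_self (fun w => fourierL2 u w * fourierL2 v (z - w))]
  refine integral_congr_ae ?_
  filter_upwards [fourierL2_cylKernel_mul hv z] with w hw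
  rw [hw, sub_neg_eq_add, add_comm]

/-- If the convolution of the absolute values of the Fourier transforms of `u` and `v` is
square-integrable, then so is `u v`, and its transform is the convolution. -/
theorem memLp_mul_and_fourierL2_mul {u v : Cyl lam → ℂ} (hu : MemLp u 2 volume)
    (hv : MemLp v 2 volume) {U V : Freq → ℂ} (hUm : Measurable U) (hVm : Measurable V)
    (hU : fourierL2 u =ᵐ[freqMeasure lam] U) (hV : fourierL2 v =ᵐ[freqMeasure lam] V)
    (hconv : ∫⁻ z, (∫⁻ w, ‖U w‖ₑ * ‖V (z - w)‖ₑ ∂(freqMeasure lam)) ^ 2 ∂(freqMeasure lam) ≠ ⊤) :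
    MemLp (fun p => u p * v p) 2 volume ∧
    fourierL2 (fun p => u p * v p) =ᵐ[freqMeasure lam]
      fun z => (cylConst : ℂ)⁻¹ * ∫ w, U w * V (z - w) ∂(freqMeasure lam) := by
  set μ := freqMeasure lam with hμ
  set A : ℕ → Set Freq := spanningSets μ with hA
  have hAm : ∀ n, MeasurableSet (A n) := measurableSet_spanningSets μ
  have hU2 : MemLp U 2 μ := (memLp_fourierL2 hu).ae_eq hU
  have hV2 : MemLp V 2 μ := (memLp_fourierL2 hv).ae_eq hV
  have hUn2 : ∀ n, MemLp ((A n).indicator U) 2 μ := fun n => hU2.indicator (hAm n)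
  have hUn1 : ∀ n, Integrable ((A n).indicator U) μ := fun n => by
    rw [integrable_indicator_iff (hAm n)]
    have : IsFiniteMeasure (μ.restrict (A n)) := ⟨by simpa using measure_spanningSets_lt_top μ n⟩
    exact (hU2.restrict _).integrable (by norm_num)
  have hAe : ∀ z, ∀ᶠ n in atTop, z ∈ A n := fun z => by
    have : z ∈ ⋃ n, A n := by simp [hA, iUnion_spanningSets]
    obtain ⟨n, hn⟩ := Set.mem_iUnion.1 this
    filter_upwards [eventually_ge_atTop n] with m hm
    exact monotone_spanningSets μ hm hn
  -- Restricting `U` to sets of finite measure makes it integrable, so `un n` is bounded. Thus `un n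
  -- * v` lies in `L²` even though nothing of the kind is known yet for `u * v`.
  set un : ℕ → Cyl lam → ℂ := fun n p =>
    (cylConst : ℂ)⁻¹ * ∫ z, starRingEnd ℂ (cylKernel lam z p) * (A n).indicator U z ∂μ with hun
  have hun2 : ∀ n, MemLp (un n) 2 volume := fun n => (fourierL2_inverse (hUn1 n) (hUn2 n)).1
  have hunF : ∀ n, fourierL2 (un n) =ᵐ[μ] (A n).indicator U :=
    fun n => (fourierL2_inverse (hUn1 n) (hUn2 n)).2
  have hunb : ∀ n, ∃ C, ∀ p, ‖un n p‖ ≤ C := fun n => by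
    refine ⟨‖(cylConst : ℂ)⁻¹‖ * ∫ z, ‖(A n).indicator U z‖ ∂μ, fun p => ?_⟩
    rw [hun, norm_mul]
    gcongr
    refine norm_integral_le_of_norm_le (hUn1 n).norm (ae_of_all _ fun z => ?_)
    rw [norm_mul, RCLike.norm_conj]
    exact mul_le_of_le_one_left (norm_nonneg _) (norm_cylKernel_le _ _)
  -- convergence of the band-limited approximations
  have hlim : Tendsto (fun n => eLpNorm (un n - u) 2 volume) atTop (𝓝 0) := by
    refine tendsto_eLpNorm_of_fourierL2 hun2 hu ?_
    have e : ∀ n, eLpNorm (fourierL2 (un n) - fourierL2 u) 2 μ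
        = eLpNorm ((A n).indicator U - U) 2 μ := fun n => by
      refine eLpNorm_congr_ae ?_
      filter_upwards [hunF n, hU] with z h1 h2
      simp [h1, h2]
    rw [funext e]
    refine tendsto_eLpNorm_two_of_dominated (fun z => ‖U z‖ₑ) (fun n => (hUn2 n).1.sub hU2.1)
      (memLp_two_iff_lintegral.1 hU2).2.ne (fun n => ae_of_all _ fun z => ?_)
      (ae_of_all _ fun z => ?_)
    · by_cases hz : z ∈ A n <;> simp [hz]
    · refine tendsto_const_nhds.congr' ?_
      filter_upwards [hAe z] with n hn
      simp [hn]
  have hprod2 : ∀ n, MemLp (fun p => un n p * v p) 2 volume := fun n => by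
    obtain ⟨C, hC⟩ := hunb n
    refine (hv.const_mul (C : ℂ)).of_le ((hun2 n).1.mul hv.1) (ae_of_all _ fun p => ?_)
    have hC0 : 0 ≤ C := (norm_nonneg _).trans (hC p)
    rw [norm_mul (un n p), norm_mul (C : ℂ), Complex.norm_real, Real.norm_of_nonneg hC0]
    gcongr
    exact hC p
  have hprodF : ∀ n, fourierL2 (fun p => un n p * v p) =ᵐ[μ]
      fun z => (cylConst : ℂ)⁻¹ * ∫ w, (A n).indicator U w * V (z - w) ∂μ := fun n => by
    refine (fourierL2_of_integrable ((hun2 n).integrable_mul hv) (hprod2 n)).trans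
      (ae_of_all _ fun z => ?_)
    change ∫ p, cylKernel lam z p * (un n p * v p) = _
    rw [integral_cylKernel_mul_mul (hun2 n) hv, integral_convolution_congr (hunF n) hV]
  -- the convolution
  set W : Freq → ℂ := fun z => (cylConst : ℂ)⁻¹ * ∫ w, U w * V (z - w) ∂μ with hW
  set G : Freq → ℝ≥0∞ := fun z => ∫⁻ w, ‖U w‖ₑ * ‖V (z - w)‖ₑ ∂μ with hG
  have hUVm : Measurable fun q : Freq × Freq => U q.2 * V (q.1 - q.2) :=
    (hUm.comp measurable_snd).mul (hVm.comp (measurable_fst.sub measurable_snd))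
  have hGm : Measurable G := by
    refine Measurable.lintegral_prod_right'
      (f := fun q : Freq × Freq => ‖U q.2‖ₑ * ‖V (q.1 - q.2)‖ₑ) ?_
    simp_rw [← enorm_mul]
    exact hUVm.enorm
  have hGfin : ∀ᵐ z ∂μ, G z < ⊤ := by
    filter_upwards [ae_lt_top (hGm.pow_const 2) hconv] with z hz
    by_contra h
    simp [not_lt_top_iff.1 h] at hz
  have hint : ∀ᵐ z ∂μ, Integrable (fun w => U w * V (z - w)) μ := by
    filter_upwards [hGfin] with z hz
    refine ⟨(hUVm.comp measurable_prodMk_left).aestronglyMeasurable, ?_⟩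
    simpa only [HasFiniteIntegral, enorm_mul] using hz
  have hWm : AEStronglyMeasurable W μ :=
    ((StronglyMeasurable.integral_prod_right (f := fun z w => U w * V (z - w))
      hUVm.stronglyMeasurable).const_mul _).aestronglyMeasurable
  have hWb : ∀ z, ‖W z‖ₑ ≤ ‖(cylConst : ℂ)⁻¹‖ₑ * G z := fun z => by
    rw [hW, enorm_mul]
    gcongr
    refine (enorm_integral_le_lintegral_enorm _).trans_eq ?_
    simp only [enorm_mul, hG]
  have hGc : ∫⁻ z, (‖(cylConst : ℂ)⁻¹‖ₑ * G z) ^ 2 ∂μ ≠ ⊤ := by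
    simp_rw [mul_pow]
    rw [lintegral_const_mul' _ _ (by simp)]
    exact ENNReal.mul_ne_top (by simp) hconv
  have hW2 : MemLp W 2 μ := memLp_two_iff_lintegral.2 ⟨hWm,
    (lintegral_mono fun z => by gcongr; exact hWb z).trans_lt hGc.lt_top⟩
  -- The candidate for `u * v` is the inverse transform of the convolution; it remains to identify
  -- it with the pointwise product.
  obtain ⟨w, hw2, hwF⟩ := exists_fourierL2_eq hW2
  have hlimF : Tendsto (fun n => eLpNorm (fourierL2 (fun p => un n p * v p) - fourierL2 w) 2 μ)
      atTop (𝓝 0) := by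
    -- The error is the convolution integral over the complement of `A n`. It is dominated by the
    -- square-integrable convolution of absolute values and tends to zero.
    have e : ∀ n, fourierL2 (fun p => un n p * v p) - fourierL2 w =ᵐ[μ]
        fun z => (cylConst : ℂ)⁻¹ * ∫ w, (A n)ᶜ.indicator (fun w => -(U w * V (z - w))) w ∂μ := by
      intro n
      filter_upwards [hprodF n, hwF, hint] with z h1 h2 h3
      have h4 : Integrable (fun w => (A n).indicator U w * V (z - w)) μ := by
        have := h3.indicator (hAm n)
        refine this.congr (ae_of_all _ fun w => ?_)
        by_cases hw : w ∈ A n <;> simp [hw]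
      rw [Pi.sub_apply, h1, h2, hW, ← mul_sub, ← integral_sub h4 h3]
      congr 2
      funext w
      by_cases hw : w ∈ A n <;> simp [hw]
    simp_rw [fun n => eLpNorm_congr_ae (p := 2) (e n)]
    refine tendsto_eLpNorm_two_of_dominated (fun z => ‖(cylConst : ℂ)⁻¹‖ₑ * G z) (fun n => ?_) hGc
      (fun n => ae_of_all _ fun z => ?_) ?_
    · exact (((memLp_fourierL2 (hprod2 n)).sub (memLp_fourierL2 hw2)).1).congr (e n)
    · rw [enorm_mul]
      gcongr
      refine (enorm_integral_le_lintegral_enorm _).trans ?_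
      refine lintegral_mono fun w => ?_
      by_cases hw : w ∈ A n <;> simp [hw, enorm_mul]
    · filter_upwards [hint] with z hz
      have : Tendsto (fun n => ∫ w, (A n)ᶜ.indicator (fun w => -(U w * V (z - w))) w ∂μ) atTop
          (𝓝 (∫ _, (0 : ℂ) ∂μ)) := by
        refine tendsto_integral_of_dominated_convergence (fun w => ‖U w * V (z - w)‖)
          (fun n => (hz.neg.indicator (hAm n).compl).1) hz.norm
          (fun n => ae_of_all _ fun w => ?_) (ae_of_all _ fun w => ?_)
        · by_cases hw : w ∈ A n
          · simpa [hw] using mul_nonneg (norm_nonneg (U w)) (norm_nonneg (V (z - w)))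
          · simp [hw]
        · refine tendsto_const_nhds.congr' ?_
          filter_upwards [hAe w] with n hn
          simp [hn]
      have := this.const_mul ((cylConst : ℂ)⁻¹)
      simpa using this
  have hlimw := tendsto_eLpNorm_of_fourierL2 hprod2 hw2 hlimF
  -- The products converge to `w` in `L²` and to `u * v` in `L¹`. Both imply convergence in measure,
  -- where limits are unique.
  have hm1 : TendstoInMeasure volume (fun n p => un n p * v p) atTop w :=
    tendstoInMeasure_of_tendsto_eLpNorm (by norm_num) (fun n => (hprod2 n).1) hw2.1 hlimw
  have hm2 : TendstoInMeasure volume (fun n p => un n p * v p) atTop (fun p => u p * v p) := by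
    refine tendstoInMeasure_of_tendsto_eLpNorm (p := 1) (by norm_num) (fun n => (hprod2 n).1)
      (hu.1.mul hv.1) ?_
    have hb : ∀ n, eLpNorm ((fun p => un n p * v p) - fun p => u p * v p) 1 volume
        ≤ eLpNorm (un n - u) 2 volume * eLpNorm v 2 volume := fun n => by
      have e : ((fun p => un n p * v p) - fun p => u p * v p) = (un n - u) • v := by
        funext p
        simp [sub_mul]
      rw [e]
      exact eLpNorm_smul_le_mul_eLpNorm hv.1 ((hun2 n).1.sub hu.1)
    refine tendsto_of_tendsto_of_tendsto_of_le_of_le tendsto_const_nhds ?_ (fun _ => bot_le) hb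
    have := ENNReal.Tendsto.mul_const (b := eLpNorm v 2 volume) hlim (Or.inr hv.2.ne)
    simpa using this
  have hae : w =ᵐ[volume] fun p => u p * v p := tendstoInMeasure_ae_unique hm1 hm2
  have huv : MemLp (fun p => u p * v p) 2 volume := hw2.ae_eq hae
  refine ⟨huv, EventuallyEq.trans ?_ hwF⟩
  have e : hw2.toLp w = huv.toLp _ := MemLp.toLp_congr _ _ hae
  exact (l2Map_ae_eq huv).trans (by rw [← e]; exact (l2Map_ae_eq hw2).symm)

/-! ### Translations and difference quotients in `x` -/

theorem measurePreserving_translateX (r : ℝ) :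
    MeasurePreserving (fun p : Cyl lam => (p.1 + r, p.2)) volume volume :=
  (measurePreserving_add_right volume r).prod (MeasurePreserving.id _)

/-- Translation does not commute with truncation to boxes, so `IsFourier` cannot be checked directly
as for conjugation and modulation. The rule is an exact change of variables for the integrable
cut-offs and passes to the `L²` limit. -/
theorem fourierL2_translateX {g : Cyl lam → ℂ} (hg : MemLp g 2 volume) (r : ℝ) :
    fourierL2 (fun p => g (p.1 + r, p.2)) =ᵐ[freqMeasure lam]
      fun z => Complex.exp (Complex.I * ((r * z.1 : ℝ) : ℂ)) * fourierL2 g z := by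
  have hT := measurePreserving_translateX (lam := lam) r
  have hE : Measurable fun z : Freq => Complex.exp (Complex.I * ((r * z.1 : ℝ) : ℂ)) := by
    fun_prop
  have hE1 : ∀ z : Freq, ‖Complex.exp (Complex.I * ((r * z.1 : ℝ) : ℂ))‖ = 1 := fun z => by
    rw [mul_comm, Complex.norm_exp_ofReal_mul_I]
  have hmul : ∀ {V : Freq → ℂ}, MemLp V 2 (freqMeasure lam) →
      MemLp (fun z => Complex.exp (Complex.I * ((r * z.1 : ℝ) : ℂ)) * V z) 2 (freqMeasure lam) :=
    fun hV => hV.of_le (hE.aestronglyMeasurable.mul hV.1)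
      (ae_of_all _ fun z => by rw [norm_mul, hE1, one_mul])
  set gn : ℕ → Cyl lam → ℂ := fun n => (box lam n).indicator g with hgn
  have hgn2 : ∀ n, MemLp (gn n) 2 volume := fun n => memLp_indicator_box hg n
  have hgn1 : ∀ n, Integrable (gn n) volume := fun n => integrable_indicator_box hg n
  have hlim : Tendsto (fun n => eLpNorm (gn n - g) 2 volume) atTop (𝓝 0) :=
    (tendsto_eLpNorm_indicator_box hg).comp tendsto_natCast_atTop_atTop
  have hF : ∀ n, fourierL2 (fun p => gn n (p.1 + r, p.2)) =ᵐ[freqMeasure lam]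
      fun z => Complex.exp (Complex.I * ((r * z.1 : ℝ) : ℂ)) * fourierL2 (gn n) z := by
    intro n
    refine (fourierL2_of_integrable (hT.integrable_comp_of_integrable (hgn1 n))
      ((hgn2 n).comp_measurePreserving hT)).trans ?_
    filter_upwards [fourierL2_of_integrable (hgn1 n) (hgn2 n)] with z hz
    have hemb : MeasurableEmbedding (fun p : Cyl lam => (p.1 + r, p.2)) :=
      ((MeasurableEquiv.addRight r).prodCongr (MeasurableEquiv.refl _)).measurableEmbedding
    have hc := hT.integral_comp hemb
      (fun p => Complex.exp (Complex.I * ((r * z.1 : ℝ) : ℂ)) * (cylKernel lam z p * gn n p))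
    rw [hz, ← integral_const_mul, ← hc]
    refine integral_congr_ae (ae_of_all _ fun p => ?_)
    have h : Complex.exp (-Complex.I * ((p.1 * z.1 : ℝ) : ℂ))
        = Complex.exp (Complex.I * ((r * z.1 : ℝ) : ℂ)) *
          Complex.exp (-Complex.I * (((p.1 + r) * z.1 : ℝ) : ℂ)) := by
      rw [← Complex.exp_add]
      congr 1
      push_cast
      ring
    simp only [cylKernel, Function.comp]
    rw [h]
    ring
  refine fourierL2_of_tendsto (fun n => (hgn2 n).comp_measurePreserving hT)
    (hg.comp_measurePreserving hT) (hmul (memLp_fourierL2 hg)) ?_ ?_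
  · refine hlim.congr fun n => ?_
    rw [← eLpNorm_comp_measurePreserving ((hgn2 n).1.sub hg.1) hT]
    rfl
  · have e : ∀ n, eLpNorm ((fourierL2 fun p => gn n (p.1 + r, p.2)) - fun z =>
        Complex.exp (Complex.I * ((r * z.1 : ℝ) : ℂ)) * fourierL2 g z) 2 (freqMeasure lam)
        = ENNReal.ofReal √cylConst * eLpNorm (gn n - g) 2 volume := by
      intro n
      rw [← eLpNorm_fourierL2 ((hgn2 n).sub hg)]
      refine eLpNorm_congr_norm_ae ?_
      filter_upwards [hF n, fourierL2_sub (hgn2 n) hg] with z h1 h2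
      have h3 : fourierL2 (gn n - g) z = fourierL2 (gn n) z - fourierL2 g z := h2
      rw [Pi.sub_apply, h1, h3, ← mul_sub, norm_mul, hE1, one_mul]
    have := ENNReal.Tendsto.const_mul (a := ENNReal.ofReal √cylConst) hlim (Or.inr (by simp))
    rw [mul_zero] at this
    exact this.congr fun n => (e n).symm

theorem memLp_diffQuotX {g : Cyl lam → ℂ} (hg : MemLp g 2 volume) (r : ℝ) :
    MemLp (diffQuotX g r) 2 volume := by
  have h := ((hg.comp_measurePreserving (measurePreserving_translateX r)).sub hg).const_mul
    ((r : ℂ)⁻¹)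
  refine h.ae_eq (ae_of_all _ fun p => ?_)
  simp [diffQuotX, div_eq_inv_mul]

theorem fourierL2_diffQuotX {g : Cyl lam → ℂ} (hg : MemLp g 2 volume) (r : ℝ) :
    fourierL2 (diffQuotX g r) =ᵐ[freqMeasure lam]
      fun z => (Complex.exp (Complex.I * ((r * z.1 : ℝ) : ℂ)) - 1) / (r : ℂ) * fourierL2 g z := by
  have hT := hg.comp_measurePreserving (measurePreserving_translateX r)
  have e : diffQuotX g r = fun p => (r : ℂ)⁻¹ * (g (p.1 + r, p.2) - g p) := by
    funext p
    simp [diffQuotX, div_eq_inv_mul]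
  rw [e]
  filter_upwards [fourierL2_const_mul (r : ℂ)⁻¹ (hT.sub hg), fourierL2_sub hT hg,
    fourierL2_translateX hg r] with z h1 h2 h3
  have h1' : fourierL2 (fun p => (r : ℂ)⁻¹ * (g (p.1 + r, p.2) - g p)) z
    = (r : ℂ)⁻¹ * fourierL2 (fun p => g (p.1 + r, p.2) - g p) z := h1
  have h2' : fourierL2 (fun p => g (p.1 + r, p.2) - g p) z
    = fourierL2 (fun p => g (p.1 + r, p.2)) z - fourierL2 g z := h2
  rw [h1', h2', h3]
  ring

end Transform

/-! ### Integrable weights and the bilinear convolution estimate -/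

theorem one_le_bracket (x : ℝ) : 1 ≤ bracket x := by
  unfold bracket
  linarith [abs_nonneg x]

theorem bracket_pos (x : ℝ) : 0 < bracket x := one_pos.trans_le (one_le_bracket x)

/-- The integral of `⟨x⟩ ^ (-a)` over the real line. -/
noncomputable def bracketIntegral (a : ℝ) : ℝ≥0∞ := ∫⁻ x : ℝ, ENNReal.ofReal (bracket x ^ (-a))

theorem bracketIntegral_lt_top {a : ℝ} (ha : 1 < a) : bracketIntegral a < ⊤ :=
  finite_integral_one_add_norm (E := ℝ) (μ := volume) (r := a) (by simpa using ha)

theorem measurable_bracket : Measurable bracket := by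
  unfold bracket
  fun_prop

/-- For `x` in `(k, k + 1]` and `λ > 1` one has `⟨x/λ⟩ ≤ 2 ⟨k/λ⟩`, so the sum is at most a multiple
of the integral. The factor `λ` produced by rescaling cancels the `1/λ` of the frequency measure,
which makes the estimates uniform in `λ`. -/
theorem tsum_bracket_le {lam a : ℝ} (hlam : 1 < lam) (ha : 0 ≤ a) :
    ∑' k : ℤ, ENNReal.ofReal (bracket (k / lam) ^ (-a))
      ≤ ENNReal.ofReal (2 ^ a) * (ENNReal.ofReal lam * bracketIntegral a) := by
  have h0 : 0 < lam := by linarith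
  rw [bracketIntegral, ← lintegral_comp_div_const _ h0, ← lintegral_const_mul' _ _ (by simp),
    ← setLIntegral_univ, ← iUnion_Ioc_intCast ℝ,
    lintegral_iUnion (fun _ => measurableSet_Ioc) (Set.pairwise_disjoint_Ioc_intCast ℝ)]
  refine ENNReal.tsum_le_tsum fun k => ?_
  have hvol : volume (Set.Ioc (k : ℝ) (k + 1)) = 1 := by simp
  calc ENNReal.ofReal (bracket (k / lam) ^ (-a))
      = ∫⁻ _ in Set.Ioc (k : ℝ) (k + 1), ENNReal.ofReal (bracket (k / lam) ^ (-a)) := by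
        rw [setLIntegral_const, hvol, mul_one]
    _ ≤ _ := by
      refine setLIntegral_mono' measurableSet_Ioc fun x hx => ?_
      rw [← ENNReal.ofReal_mul (by positivity)]
      refine ENNReal.ofReal_le_ofReal ?_
      have h1 : bracket (x / lam) ≤ 2 * bracket (k / lam) := by
        unfold bracket
        rw [abs_div, abs_div, abs_of_pos h0]
        have h2 : |x| ≤ |(k : ℝ)| + 1 := by
          have : |x - k| ≤ 1 := abs_le.2 ⟨by linarith [hx.1], by linarith [hx.2]⟩
          calc |x| = |k + (x - k)| := by ring_nf
            _ ≤ _ := (abs_add_le _ _).trans (by linarith)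
        have h3 : |x| / lam ≤ |(k : ℝ)| / lam + 1 := by
          rw [div_le_iff₀ h0, add_mul, div_mul_cancel₀ _ h0.ne']
          linarith
        have : 0 ≤ |(k : ℝ)| / lam := by positivity
        linarith
      have h4 : (2 * bracket (k / lam)) ^ (-a) ≤ bracket (x / lam) ^ (-a) :=
        Real.rpow_le_rpow_of_nonpos (bracket_pos _) h1 (by linarith)
      rw [Real.mul_rpow (by norm_num) (bracket_pos _).le] at h4
      calc bracket (k / lam) ^ (-a) = 2 ^ a * (2 ^ (-a) * bracket (k / lam) ^ (-a)) := by
            rw [← mul_assoc, ← Real.rpow_add (by norm_num)]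
            simp
        _ ≤ _ := by gcongr

/-- The bracket `⟨|ζ|⟩` of the spatial frequency. -/
noncomputable def spaceBr (lam : ℝ) (z : Freq) : ℝ := bracket (absz (zeta lam z))

/-- The modulation `⟨τ - σ(ζ)⟩`. -/
noncomputable def modBr (lam : ℝ) (z : Freq) : ℝ := bracket (z.2.2 - sigma (zeta lam z))

theorem measurable_zeta (lam : ℝ) : Measurable (zeta lam) := by
  have : Measurable fun z : Freq => (z.2.1 : ℝ) :=
    (measurable_of_countable (fun k : ℤ => (k : ℝ))).comp measurable_snd.fst
  exact measurable_fst.prodMk (this.div_const lam)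

theorem continuous_absz : Continuous absz := by
  unfold absz
  fun_prop

theorem measurable_spaceBr (lam : ℝ) : Measurable (spaceBr lam) :=
  measurable_bracket.comp (continuous_absz.measurable.comp (measurable_zeta lam))

theorem measurable_modBr (lam : ℝ) : Measurable (modBr lam) := by
  have : Measurable sigma := by
    unfold sigma
    fun_prop
  exact measurable_bracket.comp (measurable_snd.snd.sub (this.comp (measurable_zeta lam)))

theorem one_le_spaceBr (lam : ℝ) (z : Freq) : 1 ≤ spaceBr lam z := one_le_bracket _

theorem one_le_modBr (lam : ℝ) (z : Freq) : 1 ≤ modBr lam z := one_le_bracket _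

theorem abs_fst_le_absz (ζ : ℝ × ℝ) : |ζ.1| ≤ absz ζ := by
  refine Real.abs_le_sqrt ?_
  nlinarith [sq_nonneg ζ.1, sq_nonneg ζ.2]

theorem abs_snd_le_absz (ζ : ℝ × ℝ) : |ζ.2| ≤ absz ζ := by
  refine Real.abs_le_sqrt ?_
  nlinarith [sq_nonneg ζ.1, sq_nonneg ζ.2]

theorem absz_nonneg (ζ : ℝ × ℝ) : 0 ≤ absz ζ := Real.sqrt_nonneg _

theorem bracket_absz (ζ : ℝ × ℝ) : bracket (absz ζ) = 1 + absz ζ := by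
  rw [bracket, abs_of_nonneg (absz_nonneg ζ)]

theorem absz_add_le (ζ η : ℝ × ℝ) : absz (ζ + η) ≤ absz ζ + absz η := by
  refine Real.sqrt_le_iff.2 ⟨add_nonneg (absz_nonneg _) (absz_nonneg _), ?_⟩
  have h1 : absz ζ ^ 2 = 3 * ζ.1 ^ 2 + ζ.2 ^ 2 := Real.sq_sqrt (by positivity)
  have h2 : absz η ^ 2 = 3 * η.1 ^ 2 + η.2 ^ 2 := Real.sq_sqrt (by positivity)
  have h3 : 3 * (ζ.1 * η.1) + ζ.2 * η.2 ≤ absz ζ * absz η := by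
    refine le_of_abs_le (abs_le_of_sq_le_sq ?_ (mul_nonneg (absz_nonneg _) (absz_nonneg _)))
    rw [mul_pow, h1, h2]
    nlinarith [sq_nonneg (ζ.1 * η.2 - ζ.2 * η.1)]
  simp only [Prod.fst_add, Prod.snd_add]
  nlinarith

/-- Giving half of the decay to each coordinate makes the weight factorise; integrability then needs
`p / 2 > 1` in each, the same threshold `p > 2` as for the planar weight. -/
theorem spaceBr_rpow_neg_le {lam p : ℝ} (hp : 0 ≤ p) (z : Freq) :
    spaceBr lam z ^ (-p) ≤ bracket z.1 ^ (-(p / 2)) * bracket (z.2.1 / lam) ^ (-(p / 2)) := by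
  have h1 : bracket z.1 ≤ spaceBr lam z := by
    rw [spaceBr, bracket_absz, bracket]
    have : |z.1| ≤ absz (zeta lam z) := abs_fst_le_absz (zeta lam z)
    linarith
  have h2 : bracket (z.2.1 / lam) ≤ spaceBr lam z := by
    rw [spaceBr, bracket_absz, bracket]
    have : |z.2.1 / lam| ≤ absz (zeta lam z) := abs_snd_le_absz (zeta lam z)
    linarith
  have h0 : 0 < spaceBr lam z := bracket_pos _
  have e : spaceBr lam z ^ (-p) = spaceBr lam z ^ (-(p / 2)) * spaceBr lam z ^ (-(p / 2)) := by
    rw [← Real.rpow_add h0]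
    congr 1
    ring
  rw [e]
  have h3 := Real.rpow_le_rpow_of_nonpos (bracket_pos _) h1 (show -(p / 2) ≤ 0 by linarith)
  have h4 := Real.rpow_le_rpow_of_nonpos (bracket_pos _) h2 (show -(p / 2) ≤ 0 by linarith)
  exact mul_le_mul h3 h4 (Real.rpow_nonneg h0.le _) (Real.rpow_nonneg (bracket_pos _).le _)

/-- The weight `⟨|ζ|⟩ ^ (-p) ⟨τ - σ(ζ)⟩ ^ (-2 b)` is integrable, uniformly in the period. -/
theorem lintegral_weight_le {lam p b : ℝ} (hlam : 1 < lam) (hp : 0 ≤ p) :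
    ∫⁻ z, ENNReal.ofReal (spaceBr lam z ^ (-p) * modBr lam z ^ (-(2 * b))) ∂(freqMeasure lam)
      ≤ ENNReal.ofReal (2 ^ (p / 2)) * bracketIntegral (p / 2) ^ 2 * bracketIntegral (2 * b) := by
  have h0 : 0 < lam := by linarith
  set A := fun x : ℝ => ENNReal.ofReal (bracket x ^ (-(p / 2))) with hA
  have hAm : Measurable A := (measurable_bracket.pow_const _).ennreal_ofReal
  obtain ⟨T, hT⟩ : ∃ T : ℝ → ℤ → ℝ → ℝ≥0∞, ∀ ξ k τ, T ξ k τ = A ξ * (A (k / lam) *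
    ENNReal.ofReal (bracket (τ - sigma (ξ, k / lam)) ^ (-(2 * b)))) := ⟨_, fun _ _ _ => rfl⟩
  have hle : ∀ z : Freq, ENNReal.ofReal (spaceBr lam z ^ (-p) * modBr lam z ^ (-(2 * b)))
      ≤ T z.1 z.2.1 z.2.2 := fun z => by
    simp only [hT, hA]
    rw [← ENNReal.ofReal_mul (Real.rpow_nonneg (bracket_pos _).le _),
      ← ENNReal.ofReal_mul (Real.rpow_nonneg (bracket_pos _).le _), ← mul_assoc]
    refine ENNReal.ofReal_le_ofReal ?_
    exact mul_le_mul_of_nonneg_right (spaceBr_rpow_neg_le hp z)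
      (Real.rpow_nonneg (bracket_pos _).le _)
  have hTm : Measurable fun z : Freq => T z.1 z.2.1 z.2.2 := by
    have h1 : Measurable fun z : Freq => A (z.2.1 / lam) := hAm.comp (measurable_zeta lam).snd
    simp_rw [hT]
    exact (hAm.comp measurable_fst).mul
      (h1.mul ((measurable_modBr lam).pow_const _).ennreal_ofReal)
  refine (lintegral_mono hle).trans ?_
  -- The dispersion relation enters only as a shift of `τ`, which the integral does not see.
  have hτ : ∀ c : ℝ, ∫⁻ τ : ℝ, ENNReal.ofReal (bracket (τ - c) ^ (-(2 * b)))
      = bracketIntegral (2 * b) := fun c =>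
    lintegral_sub_right_eq_self (fun τ => ENNReal.ofReal (bracket τ ^ (-(2 * b)))) c
  have h1 : ∀ ξ : ℝ, ∫⁻ y : ℤ × ℝ, T ξ y.1 y.2 ∂(Measure.count.prod volume)
      = A ξ * ((∑' k : ℤ, A (k / lam)) * bracketIntegral (2 * b)) := fun ξ => by
    have hm : Measurable fun y : ℤ × ℝ => T ξ y.1 y.2 :=
      hTm.comp (measurable_prodMk_left (x := ξ))
    rw [lintegral_prod _ hm.aemeasurable, lintegral_count]
    simp only [hT]
    rw [← ENNReal.tsum_mul_right, ← ENNReal.tsum_mul_left]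
    refine tsum_congr fun k => ?_
    have hAt : ∀ y, A y ≠ ⊤ := fun y => ENNReal.ofReal_ne_top
    rw [lintegral_const_mul' (A ξ) _ (hAt ξ), lintegral_const_mul' (A (k / lam)) _ (hAt _),
      hτ (sigma (ξ, k / lam))]
  rw [freqMeasure, lintegral_smul_measure, lintegral_prod _ hTm.aemeasurable]
  simp_rw [h1]
  rw [lintegral_mul_const _ hAm]
  have h2 := tsum_bracket_le (a := p / 2) hlam (by linarith)
  have h3 : ENNReal.ofReal lam⁻¹ * ENNReal.ofReal lam = 1 := by
    rw [← ENNReal.ofReal_mul (by positivity), inv_mul_cancel₀ h0.ne', ENNReal.ofReal_one]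
  calc ENNReal.ofReal lam⁻¹ • ((∫⁻ ξ, A ξ) * ((∑' k : ℤ, A (k / lam)) * bracketIntegral (2 * b)))
      ≤ ENNReal.ofReal lam⁻¹ * (bracketIntegral (p / 2) * ((ENNReal.ofReal (2 ^ (p / 2)) *
        (ENNReal.ofReal lam * bracketIntegral (p / 2))) * bracketIntegral (2 * b))) := by
        rw [smul_eq_mul]
        gcongr
        exact le_rfl
    _ = (ENNReal.ofReal lam⁻¹ * ENNReal.ofReal lam) * (ENNReal.ofReal (2 ^ (p / 2)) *
        bracketIntegral (p / 2) ^ 2 * bracketIntegral (2 * b)) := by ring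
    _ = _ := by rw [h3, one_mul]

theorem sq_lintegral_mul_le {X : Type*} [MeasurableSpace X] {μ : Measure X} {f g : X → ℝ≥0∞}
    (hf : AEMeasurable f μ) (hg : AEMeasurable g μ) :
    (∫⁻ x, f x * g x ∂μ) ^ 2 ≤ (∫⁻ x, f x ^ 2 ∂μ) * ∫⁻ x, g x ^ 2 ∂μ := by
  have h := ENNReal.lintegral_mul_le_Lp_mul_Lq μ Real.HolderConjugate.two_two hf hg
  have h2 := pow_le_pow_left' h 2
  rw [mul_pow, ← ENNReal.rpow_natCast, ← ENNReal.rpow_natCast, ← ENNReal.rpow_natCast,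
    ← ENNReal.rpow_mul, ← ENNReal.rpow_mul] at h2
  simpa using h2

/-- The Cauchy–Schwarz bound for a bilinear convolution operator with kernel `k`. -/
theorem lintegral_sq_convolution_le {lam : ℝ} {k : Freq → Freq → ℝ≥0∞} {P Q : Freq → ℝ≥0∞}
    (hk : Measurable (Function.uncurry k)) (hP : Measurable P) (hQ : Measurable Q) {C : ℝ≥0∞}
    (hC : ∀ z, ∫⁻ w, k w (z - w) ^ 2 ∂(freqMeasure lam) ≤ C) :
    ∫⁻ z, (∫⁻ w, k w (z - w) * (P w * Q (z - w)) ∂(freqMeasure lam)) ^ 2 ∂(freqMeasure lam)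
      ≤ C * ((∫⁻ z, P z ^ 2 ∂(freqMeasure lam)) * ∫⁻ z, Q z ^ 2 ∂(freqMeasure lam)) := by
  set μ := freqMeasure lam with hμ
  have hPQ : Measurable fun q : Freq × Freq => (P q.2 * Q (q.1 - q.2)) ^ 2 :=
    ((hP.comp measurable_snd).mul (hQ.comp (measurable_fst.sub measurable_snd))).pow_const 2
  have h1 : ∀ z, (∫⁻ w, k w (z - w) * (P w * Q (z - w)) ∂μ) ^ 2
      ≤ C * ∫⁻ w, (P w * Q (z - w)) ^ 2 ∂μ := fun z => by
    refine (sq_lintegral_mul_le ?_ ?_).trans (by gcongr; exact hC z)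
    · exact (hk.comp (measurable_id.prodMk (measurable_const.sub measurable_id))).aemeasurable
    · exact (hP.mul (hQ.comp (measurable_const.sub measurable_id))).aemeasurable
  refine (lintegral_mono h1).trans ?_
  have hm : Measurable fun z => ∫⁻ w, (P w * Q (z - w)) ^ 2 ∂μ := hPQ.lintegral_prod_right'
  rw [lintegral_const_mul _ hm, lintegral_lintegral_swap hPQ.aemeasurable]
  gcongr
  have h2 : ∀ w, ∫⁻ z, (P w * Q (z - w)) ^ 2 ∂μ = P w ^ 2 * ∫⁻ z, Q z ^ 2 ∂μ := fun w => by
    simp_rw [mul_pow]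
    have hm : Measurable fun z => Q (z - w) ^ 2 :=
      (hQ.comp (measurable_id.sub measurable_const)).pow_const 2
    rw [lintegral_const_mul _ hm,
      lintegral_sub_right_eq_self (fun z => Q z ^ 2) w]
  simp_rw [h2]
  rw [lintegral_mul_const _ (hP.pow_const 2)]

/-- The squared kernel is, up to symmetry, `x^(-9/20) y^(-2s) v^(-2b) w^(-2b)`. Replacing the larger
of `x`, `y` by the smaller puts the full exponent `2s + 9/20` on the smaller frequency, and the
other modulation is dropped. -/
theorem kernel_sq_le {s b x y v w : ℝ} (hs : 0 ≤ s) (hb : 0 ≤ b) (hx : 1 ≤ x) (hy : 1 ≤ y)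
    (hv : 1 ≤ v) (hw : 1 ≤ w) :
    ((x ^ (s - 9 / 40) + y ^ (s - 9 / 40)) / ((v ^ b * x ^ s) * (w ^ b * y ^ s))) ^ 2
      ≤ 4 * (x ^ (-(2 * s + 9 / 20)) * v ^ (-(2 * b)) + y ^ (-(2 * s + 9 / 20)) * w ^ (-(2 * b))) := by
  have hx0 : 0 < x := by linarith
  have hy0 : 0 < y := by linarith
  have hv0 : 0 < v := by linarith
  have hw0 : 0 < w := by linarith
  set S := x ^ (-(2 * s + 9 / 20)) * v ^ (-(2 * b)) + y ^ (-(2 * s + 9 / 20)) * w ^ (-(2 * b))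
    with hS
  have key : ∀ x y v w : ℝ, 1 ≤ x → 1 ≤ y → 1 ≤ v → 1 ≤ w →
      (x ^ (s - 9 / 40)) ^ 2 / ((v ^ b * x ^ s) * (w ^ b * y ^ s)) ^ 2 ≤
      x ^ (-(2 * s + 9 / 20)) * v ^ (-(2 * b)) + y ^ (-(2 * s + 9 / 20)) * w ^ (-(2 * b)) := by
    intro x y v w hx hy hv hw
    have hx0 : 0 < x := by linarith
    have hy0 : 0 < y := by linarith
    have hv0 : 0 < v := by linarith
    have hw0 : 0 < w := by linarith
    have e : (x ^ (s - 9 / 40)) ^ 2 / ((v ^ b * x ^ s) * (w ^ b * y ^ s)) ^ 2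
        = x ^ (-(9 / 20) : ℝ) * y ^ (-(2 * s)) * (v ^ (-(2 * b)) * w ^ (-(2 * b))) := by
      have e1 : (x ^ (s - 9 / 40)) ^ 2 = x ^ (-(9 / 20) : ℝ) * x ^ (2 * s) := by
        rw [← Real.rpow_natCast, ← Real.rpow_mul hx0.le, ← Real.rpow_add hx0]
        congr 1
        push_cast
        ring
      have e2 : ∀ {a c : ℝ}, 0 < a → (a ^ c) ^ 2 = a ^ (2 * c) := fun {a c} ha => by
        rw [← Real.rpow_natCast, ← Real.rpow_mul ha.le]
        congr 1
        push_cast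
        ring
      simp only [mul_pow]
      rw [e1, e2 hv0, e2 hx0, e2 hw0, e2 hy0, Real.rpow_neg hy0.le, Real.rpow_neg hv0.le,
        Real.rpow_neg hw0.le]
      have := (Real.rpow_pos_of_pos hx0 (2 * s)).ne'
      field_simp
    rw [e]
    have n1 : 0 ≤ x ^ (-(2 * s + 9 / 20)) * v ^ (-(2 * b)) := by positivity
    have n2 : 0 ≤ y ^ (-(2 * s + 9 / 20)) * w ^ (-(2 * b)) := by positivity
    have v1 : v ^ (-(2 * b)) ≤ 1 := Real.rpow_le_one_of_one_le_of_nonpos hv (by linarith)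
    have w1 : w ^ (-(2 * b)) ≤ 1 := Real.rpow_le_one_of_one_le_of_nonpos hw (by linarith)
    rcases le_total x y with hxy | hxy
    · have h1 : y ^ (-(2 * s)) ≤ x ^ (-(2 * s)) :=
        Real.rpow_le_rpow_of_nonpos hx0 hxy (by linarith)
      have e3 : x ^ (-(2 * s + 9 / 20)) = x ^ (-(9 / 20) : ℝ) * x ^ (-(2 * s)) := by
        rw [← Real.rpow_add hx0]
        congr 1
        ring
      calc _ ≤ x ^ (-(9 / 20) : ℝ) * x ^ (-(2 * s)) * (v ^ (-(2 * b)) * 1) := by gcongr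
        _ ≤ _ := by rw [mul_one, ← e3]; linarith
    · have h1 : x ^ (-(9 / 20) : ℝ) ≤ y ^ (-(9 / 20) : ℝ) :=
        Real.rpow_le_rpow_of_nonpos hy0 hxy (by norm_num)
      have e3 : y ^ (-(2 * s + 9 / 20)) = y ^ (-(9 / 20) : ℝ) * y ^ (-(2 * s)) := by
        rw [← Real.rpow_add hy0]
        congr 1
        ring
      calc _ ≤ y ^ (-(9 / 20) : ℝ) * y ^ (-(2 * s)) * (1 * w ^ (-(2 * b))) := by gcongr
        _ ≤ _ := by rw [one_mul, ← e3]; linarith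
  -- The factor 4 arises from `(a + b)² ≤ 2 (a² + b²)` and the two symmetric terms, each at most
  -- `S`.
  have h1 := key x y v w hx hy hv hw
  have h2 := key y x w v hy hx hw hv
  rw [mul_comm (w ^ b * y ^ s), add_comm (y ^ _ * _)] at h2
  rw [div_pow]
  have h3 : (x ^ (s - 9 / 40) + y ^ (s - 9 / 40)) ^ 2
      ≤ 2 * ((x ^ (s - 9 / 40)) ^ 2 + (y ^ (s - 9 / 40)) ^ 2) := by
    nlinarith [sq_nonneg (x ^ (s - 9 / 40) - y ^ (s - 9 / 40))]
  calc _ ≤ 2 * ((x ^ (s - 9 / 40)) ^ 2 + (y ^ (s - 9 / 40)) ^ 2) /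
        ((v ^ b * x ^ s) * (w ^ b * y ^ s)) ^ 2 := by gcongr
    _ = 2 * ((x ^ (s - 9 / 40)) ^ 2 / ((v ^ b * x ^ s) * (w ^ b * y ^ s)) ^ 2 +
        (y ^ (s - 9 / 40)) ^ 2 / ((v ^ b * x ^ s) * (w ^ b * y ^ s)) ^ 2) := by ring
    _ ≤ _ := by linarith

/-- The constant of the bilinear estimate. -/
noncomputable def bilinearConst (s b : ℝ) : ℝ≥0∞ :=
  8 * (ENNReal.ofReal (2 ^ ((2 * s + 9 / 20) / 2)) * bracketIntegral ((2 * s + 9 / 20) / 2) ^ 2 *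
    bracketIntegral (2 * b))

/-- This is where the thresholds act: `(2s + 9/20) / 2 > 1` is exactly `s > 31/40`, and `2b > 1` is
`b > 1/2`. -/
theorem bilinearConst_ne_top {s b : ℝ} (hs : 31 / 40 < s) (hb : 1 / 2 < b) :
    bilinearConst s b ≠ ⊤ := by
  have h1 := (bracketIntegral_lt_top (a := (2 * s + 9 / 20) / 2) (by linarith)).ne
  have h2 := (bracketIntegral_lt_top (a := 2 * b) (by linarith)).ne
  unfold bilinearConst
  finiteness

/-- The sum of the powers `⟨|ζ₁|⟩ ^ (s - 9/40) + ⟨|ζ₂|⟩ ^ (s - 9/40)`. -/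
noncomputable def pairWeight (s lam : ℝ) (w v : Freq) : ℝ :=
  spaceBr lam w ^ (s - 9 / 40) + spaceBr lam v ^ (s - 9 / 40)

theorem lintegral_sq_convolution_pairWeight_le {lam s b : ℝ} (hlam : 1 < lam) (hs : 0 ≤ s)
    (hb : 0 ≤ b) {U : Freq → ℝ≥0∞} (hU : Measurable U) :
    ∫⁻ z, (∫⁻ w, ENNReal.ofReal (pairWeight s lam w (z - w)) * (U w * U (z - w))
      ∂(freqMeasure lam)) ^ 2 ∂(freqMeasure lam)
    ≤ bilinearConst s b * (∫⁻ z, ENNReal.ofReal (modBr lam z ^ (2 * b) * spaceBr lam z ^ (2 * s)) *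
      U z ^ 2 ∂(freqMeasure lam)) ^ 2 := by
  set μ := freqMeasure lam with hμ
  set x := spaceBr lam with hx
  set v := modBr lam with hv
  have hxm : Measurable x := measurable_spaceBr lam
  have hvm : Measurable v := measurable_modBr lam
  have hx1 : ∀ z, 1 ≤ x z := one_le_spaceBr lam
  have hv1 : ∀ z, 1 ≤ v z := one_le_modBr lam
  have hW : ∀ z, 0 < v z ^ b * x z ^ s := fun z => by
    have h1 : 0 < x z := one_pos.trans_le (hx1 z)
    have h2 : 0 < v z := one_pos.trans_le (hv1 z)
    positivity
  -- The norm weights are moved from `U` into the kernel, so that the general Cauchy–Schwarz bound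
  -- applies to `P`, the weighted `U`.
  set k : Freq → Freq → ℝ≥0∞ := fun w w' => ENNReal.ofReal
    (pairWeight s lam w w' / ((v w ^ b * x w ^ s) * (v w' ^ b * x w' ^ s))) with hk
  set P : Freq → ℝ≥0∞ := fun z => ENNReal.ofReal (v z ^ b * x z ^ s) * U z with hP
  have hWm : Measurable fun z => v z ^ b * x z ^ s := (hvm.pow_const b).mul (hxm.pow_const s)
  have hkm : Measurable (Function.uncurry k) := by
    refine Measurable.ennreal_ofReal ?_
    exact (((hxm.pow_const _).comp measurable_fst).add ((hxm.pow_const _).comp measurable_snd)).div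
      ((hWm.comp measurable_fst).mul (hWm.comp measurable_snd))
  have hPm : Measurable P := hWm.ennreal_ofReal.mul hU
  set D := fun z => ENNReal.ofReal (x z ^ (-(2 * s + 9 / 20)) * v z ^ (-(2 * b))) with hD
  have hDm : Measurable D := ((hxm.pow_const _).mul (hvm.pow_const _)).ennreal_ofReal
  have hC : ∀ z, ∫⁻ w, k w (z - w) ^ 2 ∂μ ≤ bilinearConst s b := fun z => by
    have h1 : ∀ w, k w (z - w) ^ 2 ≤ 4 * (D w + D (z - w)) := fun w => by
      have h0 : ∀ z, 0 ≤ x z ^ (-(2 * s + 9 / 20)) * v z ^ (-(2 * b)) := fun z =>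
        mul_nonneg (Real.rpow_nonneg (zero_le_one.trans (hx1 z)) _)
          (Real.rpow_nonneg (zero_le_one.trans (hv1 z)) _)
      have h4 : (4 : ℝ≥0∞) = ENNReal.ofReal 4 := by norm_num
      rw [hk, hD, ← ENNReal.ofReal_pow, ← ENNReal.ofReal_add (h0 _) (h0 _), h4,
        ← ENNReal.ofReal_mul (by norm_num)]
      · exact ENNReal.ofReal_le_ofReal (kernel_sq_le hs hb (hx1 _) (hx1 _) (hv1 _) (hv1 _))
      · refine div_nonneg (add_nonneg ?_ ?_) (mul_pos (hW _) (hW _)).le <;>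
        exact Real.rpow_nonneg (zero_le_one.trans (hx1 _)) _
    refine (lintegral_mono h1).trans ?_
    rw [lintegral_const_mul' _ _ (by norm_num), lintegral_add_left hDm,
      lintegral_sub_left_eq_self D z]
    have h2 := lintegral_weight_le (p := 2 * s + 9 / 20) (b := b) hlam (by linarith)
    -- The reflected and translated copy of `D` has the same integral, which turns the pointwise 4
    -- into the 8 of `bilinearConst`.
    calc 4 * (∫⁻ w, D w ∂μ + ∫⁻ w, D w ∂μ) = 8 * ∫⁻ w, D w ∂μ := by ring
      _ ≤ _ := by
        unfold bilinearConst
        gcongr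
  have h := lintegral_sq_convolution_le (lam := lam) hkm hPm hPm hC
  have e1 : ∀ w w', k w w' * (P w * P w') = ENNReal.ofReal (pairWeight s lam w w') * (U w * U w') :=
    fun w w' => by
    have : k w w' * (ENNReal.ofReal (v w ^ b * x w ^ s) * ENNReal.ofReal (v w' ^ b * x w' ^ s))
        = ENNReal.ofReal (pairWeight s lam w w') := by
      rw [hk, ← ENNReal.ofReal_mul (hW w).le, ← ENNReal.ofReal_mul' (mul_pos (hW w) (hW w')).le,
        div_mul_cancel₀ _ (mul_pos (hW w) (hW w')).ne']
    rw [← this, hP]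
    ring
  have e2 : ∀ z, P z ^ 2 = ENNReal.ofReal (v z ^ (2 * b) * x z ^ (2 * s)) * U z ^ 2 := fun z => by
    have h1 : 0 < x z := one_pos.trans_le (hx1 z)
    have h2 : 0 < v z := one_pos.trans_le (hv1 z)
    rw [hP, mul_pow, ← ENNReal.ofReal_pow (hW z).le, mul_pow, ← Real.rpow_natCast,
      ← Real.rpow_natCast, ← Real.rpow_mul h2.le, ← Real.rpow_mul h1.le]
    simp only [Nat.cast_ofNat, mul_comm b, mul_comm s]
  simp_rw [e1, e2] at h
  rw [← sq] at h
  exact h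

/-! ### Bounds for the symbol of `I` and its commutator -/

section Symbol

variable {s N : ℝ} {m : ℝ × ℝ → ℝ}

theorem absz_zero_prod {a : ℝ} (ha : 0 ≤ a) : absz (0, a) = a := by
  simp [absz, Real.sqrt_sq ha]

/-- For `s > 1` the prescribed power would give `m > 1` at `|ζ| = 2N`, against monotonicity. So no
symbols exist there, and `s ≤ 1` is available for the sign conditions on exponents below. -/
theorem IsISymbol.exponent_le_one (hm : IsISymbol s N m) (hN : 1 ≤ N) : s ≤ 1 := by
  have h0 : 0 < N := by linarith
  have h1 : m (0, 2 * N) ≤ m (0, N) := hm.anti _ _ (by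
    rw [absz_zero_prod h0.le, absz_zero_prod (by linarith)]
    linarith)
  rw [hm.low (0, N) (absz_zero_prod h0.le).le, hm.high (0, 2 * N) (absz_zero_prod (by linarith)).ge,
    absz_zero_prod (by linarith), mul_div_cancel_right₀ _ h0.ne'] at h1
  by_contra h
  exact absurd h1 (not_le.2 (Real.one_lt_rpow (by norm_num) (by linarith)))

theorem IsISymbol.le_one (hm : IsISymbol s N m) (hN : 1 ≤ N) (ζ : ℝ × ℝ) : m ζ ≤ 1 := by
  have h0 : absz 0 = 0 := by simp [absz]
  rw [← hm.low 0 (by rw [h0]; linarith)]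
  exact hm.anti _ _ (by rw [h0]; exact absz_nonneg ζ)

/-- Up to `2N`, monotonicity gives `m ≥ 2^(s - 1) ≥ 1/2`, whence the factor 2. Beyond `2N` the
explicit power suffices, because `|ζ| / N ≤ ⟨|ζ|⟩` for `N ≥ 1`. -/
theorem IsISymbol.rpow_le (hm : IsISymbol s N m) (hN : 1 ≤ N) (hs : 0 ≤ s) (ζ : ℝ × ℝ) :
    bracket (absz ζ) ^ (s - 1) ≤ 2 * m ζ := by
  have hs1 := hm.exponent_le_one hN
  have h0 : 0 < N := by linarith
  rcases le_total (absz ζ) (2 * N) with h | h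
  · have h1 : m (0, 2 * N) ≤ m ζ := hm.anti _ _ (by rwa [absz_zero_prod (by linarith)])
    rw [hm.high (0, 2 * N) (absz_zero_prod (by linarith)).ge, absz_zero_prod (by linarith),
      mul_div_cancel_right₀ _ h0.ne'] at h1
    have h2 : (2 : ℝ) ^ (-1 : ℝ) ≤ 2 ^ (s - 1) :=
      Real.rpow_le_rpow_of_exponent_le (by norm_num) (by linarith)
    rw [Real.rpow_neg_one] at h2
    have h3 : bracket (absz ζ) ^ (s - 1) ≤ 1 :=
      Real.rpow_le_one_of_one_le_of_nonpos (one_le_bracket _) (by linarith)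
    linarith
  · have h1 : absz ζ / N ≤ bracket (absz ζ) := by
      rw [bracket_absz]
      have := div_le_self (absz_nonneg ζ) hN
      linarith
    have h2 : 0 < absz ζ / N := div_pos (by linarith) h0
    have h3 := Real.rpow_le_rpow_of_nonpos h2 h1 (show s - 1 ≤ 0 by linarith)
    rw [← hm.high ζ h] at h3
    have h4 : 0 ≤ bracket (absz ζ) ^ (s - 1) := Real.rpow_nonneg (bracket_pos _).le _
    linarith

theorem IsISymbol.nonneg (hm : IsISymbol s N m) (hN : 1 ≤ N) (hs : 0 ≤ s) (ζ : ℝ × ℝ) :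
    0 ≤ m ζ := by
  have := hm.rpow_le hN hs ζ
  have := Real.rpow_nonneg (bracket_pos (absz ζ)).le (s - 1)
  linarith

theorem abs_fst_add_le (ζ η : ℝ × ℝ) : |(ζ + η).1| ≤ bracket (absz ζ) + bracket (absz η) := by
  rw [bracket_absz, bracket_absz, Prod.fst_add]
  linarith [abs_add_le ζ.1 η.1, abs_fst_le_absz ζ, abs_fst_le_absz η]

theorem rpow_abs_fst_add_le {a : ℝ} (ha : 0 ≤ a) (ha1 : a ≤ 1) (ζ η : ℝ × ℝ) :
    |(ζ + η).1| ^ a ≤ bracket (absz ζ) ^ a + bracket (absz η) ^ a :=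
  (Real.rpow_le_rpow (abs_nonneg _) (abs_fst_add_le ζ η) ha).trans
    (Real.rpow_add_le_add_rpow (bracket_pos _).le (bracket_pos _).le ha ha1)

/-- The symbol `m(ζ₁) m(ζ₂) - m(ζ₁ + ζ₂)` vanishes unless one of the frequencies is large. -/
theorem IsISymbol.commutator_le (hm : IsISymbol s N m) (hN : 1 ≤ N) (hs : 31 / 40 < s)
    (ζ η : ℝ × ℝ) :
    |(ζ + η).1| ^ (49 / 40 - s) * |m ζ * m η - m (ζ + η)| ≤
      4 * N ^ (-(2 * s - 29 / 20)) *
        (bracket (absz ζ) ^ (s - 9 / 40) + bracket (absz η) ^ (s - 9 / 40)) := by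
  have hs1 := hm.exponent_le_one hN
  have h0 : 0 < N := by linarith
  have hs0 : 0 ≤ s := by linarith
  have hx := bracket_pos (absz ζ)
  have hy := bracket_pos (absz η)
  -- If both frequencies are at most `N / 2`, their sum is at most `N` and all three symbols equal
  -- 1.
  by_cases h : absz ζ ≤ N / 2 ∧ absz η ≤ N / 2
  · have h1 : absz (ζ + η) ≤ N := (absz_add_le ζ η).trans (by linarith [h.1, h.2])
    rw [hm.low ζ (by linarith [h.1]), hm.low η (by linarith [h.2]), hm.low _ h1]
    simp only [mul_one, sub_self, abs_zero, mul_zero]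
    positivity
  · set M := max (bracket (absz ζ)) (bracket (absz η)) with hM
    have hM0 : 0 < M := hx.trans_le (le_max_left _ _)
    have hMN : N ≤ 2 * M := by
      have h1 := le_max_left (bracket (absz ζ)) (bracket (absz η))
      have h2 := le_max_right (bracket (absz ζ)) (bracket (absz η))
      rw [← hM] at h1 h2
      rw [bracket_absz] at h1 h2
      by_contra h3
      exact h ⟨by linarith, by linarith⟩
    have hMs : M ^ (s - 9 / 40) ≤
        bracket (absz ζ) ^ (s - 9 / 40) + bracket (absz η) ^ (s - 9 / 40) := by
      have n1 : 0 ≤ bracket (absz ζ) ^ (s - 9 / 40) := by positivity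
      have n2 : 0 ≤ bracket (absz η) ^ (s - 9 / 40) := by positivity
      rcases max_choice (bracket (absz ζ)) (bracket (absz η)) with h1 | h1
      · rw [hM, h1]
        linarith
      · rw [hM, h1]
        linarith
    -- No cancellation is needed in the large-frequency region; both terms lie in `[0, 1]`.
    have hd : |m ζ * m η - m (ζ + η)| ≤ 1 := by
      have a1 := hm.nonneg hN hs0 ζ
      have a2 := hm.nonneg hN hs0 η
      have a3 := hm.nonneg hN hs0 (ζ + η)
      have b1 := hm.le_one hN ζ
      have b2 := hm.le_one hN η
      have b3 := hm.le_one hN (ζ + η)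
      have c1 : m ζ * m η ≤ 1 := mul_le_one₀ b1 a2 b2
      have c2 : 0 ≤ m ζ * m η := mul_nonneg a1 a2
      exact abs_le.2 ⟨by linarith, by linarith⟩
    have hp : ∀ a : ℝ, 0 ≤ a → a ≤ 1 → (2 * M) ^ a ≤ 2 * M ^ a := fun a h1 h2 => by
      rw [Real.mul_rpow (by norm_num) hM0.le]
      have : (2 : ℝ) ^ a ≤ 2 ^ (1 : ℝ) := Real.rpow_le_rpow_of_exponent_le (by norm_num) h2
      rw [Real.rpow_one] at this
      gcongr
    have hξ : |(ζ + η).1| ^ (49 / 40 - s) ≤ 2 * M ^ (49 / 40 - s) := by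
      refine (Real.rpow_le_rpow (abs_nonneg _) ?_ (by linarith)).trans
        (hp _ (by linarith) (by linarith))
      refine (abs_fst_add_le ζ η).trans ?_
      linarith [le_max_left (bracket (absz ζ)) (bracket (absz η)),
        le_max_right (bracket (absz ζ)) (bracket (absz η))]
    -- From `N ≤ 2M` one inserts a factor of the form `(M/N)^(2s - 29/20)` at the cost of a
    -- constant. The exponent is chosen so that `(49/40 - s) + (2s - 29/20) = s - 9/40`.
    have hNθ : 1 ≤ N ^ (-(2 * s - 29 / 20)) * (2 * M ^ (2 * s - 29 / 20)) := by
      have h1 : N ^ (2 * s - 29 / 20) ≤ 2 * M ^ (2 * s - 29 / 20) :=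
        (Real.rpow_le_rpow h0.le hMN (by linarith)).trans (hp _ (by linarith) (by linarith))
      rw [Real.rpow_neg h0.le, inv_mul_eq_div, one_le_div (by positivity)]
      exact h1
    calc |(ζ + η).1| ^ (49 / 40 - s) * |m ζ * m η - m (ζ + η)|
        ≤ 2 * M ^ (49 / 40 - s) * 1 := by gcongr
      _ ≤ 2 * M ^ (49 / 40 - s) * (N ^ (-(2 * s - 29 / 20)) * (2 * M ^ (2 * s - 29 / 20))) := by
        gcongr
      _ = 4 * N ^ (-(2 * s - 29 / 20)) * M ^ (s - 9 / 40) := by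
        have : M ^ (s - 9 / 40) = M ^ (49 / 40 - s) * M ^ (2 * s - 29 / 20) := by
          rw [← Real.rpow_add hM0]
          congr 1
          ring
        rw [this]
        ring
      _ ≤ _ := by gcongr

end Symbol

/-! ### The multiplier operator and the weak integral on the Fourier side -/

section Transform

variable {lam : ℝ} [hlam : Fact (0 < 2 * Real.pi * lam)]

theorem isMultiplierImage_multiplierOp {m : ℝ × ℝ → ℝ} (hm : Measurable m) (hm1 : ∀ ζ, |m ζ| ≤ 1)
    {u : Cyl lam → ℂ} (hu : MemLp u 2 volume) : IsMultiplierImage m u (multiplierOp m u) := by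
  have h : MemLp (fun z => (m (zeta lam z) : ℂ) * fourierL2 u z) 2 (freqMeasure lam) := by
    refine (memLp_fourierL2 hu).of_le (AEStronglyMeasurable.mul ?_ (memLp_fourierL2 hu).1)
      (ae_of_all _ fun z => ?_)
    · exact (Complex.measurable_ofReal.comp
        (hm.comp (measurable_zeta lam))).aestronglyMeasurable
    · rw [norm_mul, Complex.norm_real]
      exact mul_le_of_le_one_left (norm_nonneg _) (hm1 _)
  obtain ⟨w, hw, hw'⟩ := exists_fourierL2_eq h
  exact Classical.epsilon_spec (p := IsMultiplierImage m u) ⟨w, hw, hw'⟩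

theorem norm_exp_sub_one_div_le (r x : ℝ) :
    ‖(Complex.exp (Complex.I * ((r * x : ℝ) : ℂ)) - 1) / (r : ℂ)‖ ≤ |x| := by
  rcases eq_or_ne r 0 with rfl | hr
  · simp
  · rw [norm_div, Complex.norm_real, div_le_iff₀ (norm_pos_iff.2 hr)]
    refine (Real.norm_exp_I_mul_ofReal_sub_one_le).trans_eq ?_
    rw [Real.norm_eq_abs, Real.norm_eq_abs, abs_mul, mul_comm]

theorem tendsto_exp_sub_one_div (x : ℝ) :
    Tendsto (fun r : ℝ => (Complex.exp (Complex.I * ((r * x : ℝ) : ℂ)) - 1) / (r : ℂ)) (𝓝[≠] 0)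
      (𝓝 (Complex.I * x)) := by
  have h1 : HasDerivAt (fun r : ℝ => Complex.I * ((r * x : ℝ) : ℂ)) (Complex.I * x) 0 := by
    have := ((hasDerivAt_id (0 : ℝ)).mul_const x).ofReal_comp.const_mul Complex.I
    simpa using this
  have h2 := h1.cexp
  simp only [zero_mul, Complex.ofReal_zero, mul_zero, Complex.exp_zero, one_mul] at h2
  have h3 := h2.tendsto_slope_zero
  refine h3.congr fun r => ?_
  simp [div_eq_inv_mul]

/-- The weak integral `∫ f ∂ₓg` exists whenever the integral over the frequencies converges
absolutely. -/
theorem hasIntegralMulDx_of_fourierL2 {f g : Cyl lam → ℂ} (hf : MemLp f 2 volume)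
    (hg : MemLp g 2 volume)
    (h : ∫⁻ z, ‖z.1‖ₑ * (‖fourierL2 f (-z)‖ₑ * ‖fourierL2 g z‖ₑ) ∂(freqMeasure lam) ≠ ⊤) :
    HasIntegralMulDx f g ((cylConst : ℂ)⁻¹ *
      ∫ z, Complex.I * z.1 * (fourierL2 f (-z) * fourierL2 g z) ∂(freqMeasure lam)) := by
  have hfm : AEStronglyMeasurable (fun z => fourierL2 f (-z)) (freqMeasure lam) :=
    (memLp_fourierL2 hf).1.comp_measurePreserving (Measure.measurePreserving_neg (freqMeasure lam))
  have hfg := hfm.mul (memLp_fourierL2 hg).1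
  refine ⟨fun r _ => hf.integrable_mul (memLp_diffQuotX hg r), ?_⟩
  have e : ∀ r : ℝ, ∫ p, f p * diffQuotX g r p = (cylConst : ℂ)⁻¹ *
      ∫ z, (Complex.exp (Complex.I * ((r * z.1 : ℝ) : ℂ)) - 1) / (r : ℂ) *
        (fourierL2 f (-z) * fourierL2 g z) ∂(freqMeasure lam) := fun r => by
    rw [integral_mul_eq hf (memLp_diffQuotX hg r)]
    congr 1
    refine integral_congr_ae ?_
    filter_upwards [fourierL2_diffQuotX hg r] with z hz
    rw [hz]
    ring
  simp_rw [e]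
  refine Tendsto.const_mul _ ?_
  -- The multiplier `(e^(irξ) - 1)/r` tends to `iξ` and is bounded by `|ξ|` uniformly in `r`, so the
  -- absolute integral in `h` provides the majorant.
  refine tendsto_integral_filter_of_dominated_convergence
    (fun z => ‖(z.1 : ℂ) * (fourierL2 f (-z) * fourierL2 g z)‖) ?_ ?_ ?_ ?_
  · refine Eventually.of_forall fun r => AEStronglyMeasurable.mul ?_ hfg
    have : Measurable fun z : Freq =>
        (Complex.exp (Complex.I * ((r * z.1 : ℝ) : ℂ)) - 1) / (r : ℂ) := by fun_prop
    exact this.aestronglyMeasurable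
  · refine Eventually.of_forall fun r => ae_of_all _ fun z => ?_
    rw [norm_mul, norm_mul (z.1 : ℂ), Complex.norm_real]
    gcongr
    exact norm_exp_sub_one_div_le r z.1
  · refine Integrable.norm ⟨AEStronglyMeasurable.mul ?_ hfg, ?_⟩
    · exact (Complex.measurable_ofReal.comp measurable_fst).aestronglyMeasurable
    · rw [HasFiniteIntegral]
      refine lt_of_eq_of_lt ?_ h.lt_top
      refine lintegral_congr fun z => ?_
      rw [enorm_mul, enorm_mul, ← ofReal_norm, ← ofReal_norm (z.1), Complex.norm_real]
  · exact ae_of_all _ fun z => (tendsto_exp_sub_one_div z.1).mul_const _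

end Transform

/-! ### The weighted self-convolution that dominates both factors -/

section Energy

variable {lam : ℝ}

/-- The convolution of `|U|` with itself, weighted by `pairWeight`. -/
noncomputable def weightedConv (s lam : ℝ) (U : Freq → ℂ) (z : Freq) : ℝ≥0∞ :=
  ∫⁻ w, ENNReal.ofReal (pairWeight s lam w (z - w)) * (‖U w‖ₑ * ‖U (z - w)‖ₑ) ∂(freqMeasure lam)

theorem measurable_weightedConv {s : ℝ} {U : Freq → ℂ} (hU : Measurable U) :
    Measurable (weightedConv s lam U) := by
  refine Measurable.lintegral_prod_right' (f := fun q : Freq × Freq =>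
    ENNReal.ofReal (pairWeight s lam q.2 (q.1 - q.2)) * (‖U q.2‖ₑ * ‖U (q.1 - q.2)‖ₑ)) ?_
  have hx := (measurable_spaceBr lam).pow_const (s - 9 / 40)
  have hsub : Measurable fun q : Freq × Freq => q.1 - q.2 := measurable_fst.sub measurable_snd
  exact ((hx.comp measurable_snd).add (hx.comp hsub)).ennreal_ofReal.mul
    ((hU.comp measurable_snd).enorm.mul (hU.comp hsub).enorm)

theorem one_le_pairWeight {s : ℝ} (hs : 9 / 40 ≤ s) (w v : Freq) : 1 ≤ pairWeight s lam w v := by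
  have h1 := Real.one_le_rpow (one_le_spaceBr lam w) (show 0 ≤ s - 9 / 40 by linarith)
  have h2 := Real.one_le_rpow (one_le_spaceBr lam v) (show 0 ≤ s - 9 / 40 by linarith)
  unfold pairWeight
  linarith

/-- As the weight is at least 1, the same bilinear estimate also yields the square-integrability of
`u²` and `(Iu)²`. -/
theorem lintegral_enorm_mul_le_weightedConv {s : ℝ} (hs : 9 / 40 ≤ s) (U : Freq → ℂ) (z : Freq) :
    ∫⁻ w, ‖U w‖ₑ * ‖U (z - w)‖ₑ ∂(freqMeasure lam) ≤ weightedConv s lam U z := by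
  refine lintegral_mono fun w => ?_
  refine le_mul_of_one_le_left bot_le ?_
  rw [← ENNReal.ofReal_one]
  exact ENNReal.ofReal_le_ofReal (one_le_pairWeight hs _ _)

theorem zeta_add_zeta_sub (z w : Freq) : zeta lam w + zeta lam (z - w) = zeta lam z := by
  ext
  · simp [zeta]
  · simp only [zeta, Prod.snd_add, Prod.snd_sub, Prod.fst_sub, Int.cast_sub]
    ring

/-- A bilinear multiplier dominated by `pairWeight` after multiplication with a weight. -/
theorem ofReal_mul_enorm_integral_le {s A : ℝ} (U : Freq → ℂ) (M : Freq → ℝ) (a : ℝ) (ha : 0 ≤ a)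
    (hA : 0 ≤ A) (z : Freq) (h : ∀ w, a * |M w| ≤ A * pairWeight s lam w (z - w)) :
    ENNReal.ofReal a * ‖∫ w, (M w : ℂ) * (U w * U (z - w)) ∂(freqMeasure lam)‖ₑ
      ≤ ENNReal.ofReal A * weightedConv s lam U z := by
  calc ENNReal.ofReal a * ‖∫ w, (M w : ℂ) * (U w * U (z - w)) ∂(freqMeasure lam)‖ₑ
      ≤ ENNReal.ofReal a * ∫⁻ w, ‖(M w : ℂ) * (U w * U (z - w))‖ₑ ∂(freqMeasure lam) := by
        gcongr
        exact enorm_integral_le_lintegral_enorm _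
    _ = ∫⁻ w, ENNReal.ofReal a * ‖(M w : ℂ) * (U w * U (z - w))‖ₑ ∂(freqMeasure lam) :=
        (lintegral_const_mul' _ _ (by simp)).symm
    _ ≤ ∫⁻ w, ENNReal.ofReal A * (ENNReal.ofReal (pairWeight s lam w (z - w)) *
          (‖U w‖ₑ * ‖U (z - w)‖ₑ)) ∂(freqMeasure lam) := by
        refine lintegral_mono fun w => ?_
        have e : ‖(M w : ℂ)‖ₑ = ENNReal.ofReal |M w| := by
          rw [← ofReal_norm, Complex.norm_real, Real.norm_eq_abs]
        rw [enorm_mul, enorm_mul, e, ← mul_assoc (ENNReal.ofReal a), ← ENNReal.ofReal_mul ha,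
          ← mul_assoc (ENNReal.ofReal A), ← ENNReal.ofReal_mul hA]
        exact mul_le_mul' (ENNReal.ofReal_le_ofReal (h w)) le_rfl
    _ = _ := lintegral_const_mul' _ _ (by simp)

/-- Cauchy–Schwarz and the reflection invariance of the frequency measure. -/
theorem lintegral_neg_mul_le {G : Freq → ℝ≥0∞} (hG : Measurable G) :
    ∫⁻ z, G (-z) * G z ∂(freqMeasure lam) ≤ ∫⁻ z, G z ^ 2 ∂(freqMeasure lam) := by
  have h := sq_lintegral_mul_le (μ := freqMeasure lam) (f := fun z => G (-z)) (g := G)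
    (hG.comp measurable_neg).aemeasurable hG.aemeasurable
  rw [lintegral_neg_eq_self (fun z => G z ^ 2), ← sq] at h
  exact (ENNReal.pow_le_pow_left_iff two_ne_zero).1 h

end Energy

/-! ### The energy increment estimate -/

section Main

variable {lam : ℝ} [hlam : Fact (0 < 2 * Real.pi * lam)]

/-- The weighted norm of `û` is controlled by the Bourgain norm of `I u`. -/
theorem lintegral_weight_le_bourgainNorm {s N b : ℝ} {m : ℝ × ℝ → ℝ} (hm : IsISymbol s N m)
    (hN : 1 ≤ N) (hs : 0 ≤ s) {u w : Cyl lam → ℂ} {U : Freq → ℂ}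
    (hU : fourierL2 u =ᵐ[freqMeasure lam] U) (hw : IsMultiplierImage m u w) :
    ∫⁻ z, ENNReal.ofReal (modBr lam z ^ (2 * b) * spaceBr lam z ^ (2 * s)) * ‖U z‖ₑ ^ 2
      ∂(freqMeasure lam) ≤ 4 * bourgainNorm 1 b w ^ 2 := by
  have e : bourgainNorm 1 b w ^ 2 = ∫⁻ z, ENNReal.ofReal (modBr lam z ^ (2 * b) *
      spaceBr lam z ^ (2 * (1 : ℝ)) * ‖fourierL2 w z‖ ^ 2) ∂(freqMeasure lam) := by
    unfold bourgainNorm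
    rw [← ENNReal.rpow_natCast, ← ENNReal.rpow_mul]
    norm_num
    rfl
  rw [e, ← lintegral_const_mul' _ _ (by norm_num)]
  refine lintegral_mono_ae ?_
  filter_upwards [hU, hw.2] with z h1 h2
  have h4 : (4 : ℝ≥0∞) = ENNReal.ofReal 4 := by norm_num
  have hv : 0 < modBr lam z := bracket_pos _
  have hx : 0 < spaceBr lam z := bracket_pos _
  rw [h2, h1, ← ofReal_norm, ← ENNReal.ofReal_pow (norm_nonneg _),
    ← ENNReal.ofReal_mul (by positivity), h4, ← ENNReal.ofReal_mul (by norm_num)]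
  refine ENNReal.ofReal_le_ofReal ?_
  rw [norm_mul, Complex.norm_real, Real.norm_eq_abs, abs_of_nonneg (hm.nonneg hN hs _)]
  -- The passage from `s` derivatives of `u` to one derivative of `Iu`; squaring `2 m` accounts for
  -- the factor 4.
  have h3 : spaceBr lam z ^ (s - 1) ≤ 2 * m (zeta lam z) := hm.rpow_le hN hs _
  have h5 : spaceBr lam z ^ (2 * s)
      = spaceBr lam z ^ (2 * (1 : ℝ)) * (spaceBr lam z ^ (s - 1)) ^ 2 := by
    rw [← Real.rpow_natCast, ← Real.rpow_mul hx.le, ← Real.rpow_add hx]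
    congr 1
    push_cast
    ring
  rw [h5]
  calc modBr lam z ^ (2 * b) * (spaceBr lam z ^ (2 * (1 : ℝ)) * (spaceBr lam z ^ (s - 1)) ^ 2) *
        ‖U z‖ ^ 2
      ≤ modBr lam z ^ (2 * b) * (spaceBr lam z ^ (2 * (1 : ℝ)) * (2 * m (zeta lam z)) ^ 2) *
        ‖U z‖ ^ 2 := by gcongr
    _ = _ := by ring

/-- Everything is dominated by the single quantity `G`, the weighted self-convolution of `|û|`,
whose `L²` norm is under control. The two factors of the integrand absorb complementary powers of
`|ξ|`, and only the commutator contributes the gain in `N`. -/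
theorem energy_increment_bound {s b N : ℝ} (hs : 31 / 40 < s) (hb : 1 / 2 < b) (hlam1 : 1 < lam)
    (hN : 1 ≤ N) {m : ℝ × ℝ → ℝ} (hm : IsISymbol s N m) {u : Cyl lam → ℂ} (hu : MemLp u 2 volume)
    (hfin : bourgainNorm 1 b (multiplierOp m u) ≠ ⊤) :
    MemLp (fun p => u p ^ 2) 2 volume ∧
    MemLp (fun p => multiplierOp m u p ^ 2) 2 volume ∧
    ∃ J : ℂ, HasIntegralMulDx (multiplierOp m (fun p => u p ^ 2))
        (fun p => multiplierOp m u p ^ 2 - multiplierOp m (fun q => u q ^ 2) p) J ∧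
      ‖J‖ₑ ≤ ‖(cylConst : ℂ)⁻¹‖ₑ ^ 3 * 64 * bilinearConst s b *
        ENNReal.ofReal (N ^ (-(2 * s - 29 / 20))) * bourgainNorm 1 b (multiplierOp m u) ^ 4 := by
  have hs0 : 0 ≤ s := by linarith
  have hs1 := hm.exponent_le_one hN
  have hmm : Measurable m := hm.smooth.continuous.measurable
  have hmabs : ∀ ζ, |m ζ| ≤ 1 := fun ζ => by
    rw [abs_of_nonneg (hm.nonneg hN hs0 ζ)]
    exact hm.le_one hN ζ
  have hw := isMultiplierImage_multiplierOp hmm hmabs hu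
  set v := multiplierOp m u with hv
  set μ := freqMeasure lam with hμ
  set X := bourgainNorm 1 b v with hX
  obtain ⟨U, hUm, hU⟩ : ∃ U : Freq → ℂ, Measurable U ∧ fourierL2 u =ᵐ[μ] U :=
    ⟨_, (memLp_fourierL2 hu).1.stronglyMeasurable_mk.measurable, (memLp_fourierL2 hu).1.ae_eq_mk⟩
  set G := weightedConv s lam U with hG
  have hGm : Measurable G := measurable_weightedConv hUm
  have hGE : ∫⁻ z, G z ^ 2 ∂μ ≤ bilinearConst s b * (4 * X ^ 2) ^ 2 := by
    refine (lintegral_sq_convolution_pairWeight_le (b := b) hlam1 hs0 (by linarith)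
      hUm.enorm).trans ?_
    gcongr
    exact lintegral_weight_le_bourgainNorm hm hN hs0 hU hw
  have hGfin : ∫⁻ z, G z ^ 2 ∂μ ≠ ⊤ := by
    have := bilinearConst_ne_top hs hb
    refine ne_top_of_le_ne_top ?_ hGE
    finiteness
  set V : Freq → ℂ := fun z => (m (zeta lam z) : ℂ) * U z with hV
  have hVm : Measurable V :=
    (Complex.measurable_ofReal.comp (hmm.comp (measurable_zeta lam))).mul hUm
  have hvV : fourierL2 v =ᵐ[μ] V := by
    filter_upwards [hw.2, hU] with z h1 h2
    rw [h1, h2]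
  -- As `|m| ≤ 1`, the convolution for `(Iu)²` is bounded by the one for `u²`.
  have hVU : ∀ z, ‖V z‖ₑ ≤ ‖U z‖ₑ := fun z => by
    rw [hV, enorm_mul, ← ofReal_norm (m (zeta lam z) : ℂ), Complex.norm_real, Real.norm_eq_abs]
    exact mul_le_of_le_one_left bot_le (by simpa using hmabs (zeta lam z))
  have hUG : ∀ z, ∫⁻ w, ‖U w‖ₑ * ‖U (z - w)‖ₑ ∂μ ≤ G z :=
    lintegral_enorm_mul_le_weightedConv (by linarith) U
  obtain ⟨huu, huuF⟩ := memLp_mul_and_fourierL2_mul hu hu hUm hUm hU hU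
    (ne_top_of_le_ne_top hGfin (lintegral_mono fun z => by gcongr; exact hUG z))
  obtain ⟨hvv, hvvF⟩ := memLp_mul_and_fourierL2_mul hw.1 hw.1 hVm hVm hvV hvV
    (ne_top_of_le_ne_top hGfin (lintegral_mono fun z => by
      gcongr
      refine le_trans (lintegral_mono fun w => ?_) (hUG z)
      gcongr
      · exact hVU _
      · exact hVU _))
  simp only [← sq] at huu hvv huuF hvvF
  refine ⟨huu, hvv, ?_⟩
  have hf := isMultiplierImage_multiplierOp hmm hmabs huu
  set f := multiplierOp m (fun p => u p ^ 2) with hfdef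
  have hg : MemLp (fun p => v p ^ 2 - f p) 2 volume := hvv.sub hf.1
  set c : ℂ := (cylConst : ℂ)⁻¹ with hc
  -- the transforms of the two factors
  have hint : ∀ᵐ z ∂μ, Integrable (fun w => U w * U (z - w)) μ := by
    filter_upwards [ae_lt_top (hGm.pow_const 2) hGfin] with z hz
    have hz' : G z < ⊤ := by
      by_contra h
      simp [not_lt_top_iff.1 h] at hz
    refine ⟨(hUm.mul (hUm.comp (measurable_const.sub measurable_id))).aestronglyMeasurable, ?_⟩
    rw [HasFiniteIntegral]
    simp_rw [enorm_mul]
    exact (hUG z).trans_lt hz'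
  have hfF : fourierL2 f =ᵐ[μ] fun z =>
      c * ∫ w, ((m (zeta lam z) : ℝ) : ℂ) * (U w * U (z - w)) ∂μ := by
    filter_upwards [hf.2, huuF] with z h1 h2
    rw [h1, h2, integral_const_mul]
    ring
  have hgF : fourierL2 (fun p => v p ^ 2 - f p) =ᵐ[μ] fun z => c * ∫ w,
      ((m (zeta lam w) * m (zeta lam (z - w)) - m (zeta lam z) : ℝ) : ℂ) * (U w * U (z - w)) ∂μ := by
    filter_upwards [fourierL2_sub hvv hf.1, hfF, hvvF, hint] with z h1 h2 h3 h4
    rw [h1, h2, h3, ← mul_sub]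
    congr 1
    have hi1 : Integrable (fun w => V w * V (z - w)) μ := by
      refine h4.mono (hVm.mul (hVm.comp (measurable_const.sub measurable_id))).aestronglyMeasurable
        (ae_of_all _ fun w => ?_)
      have h5 : ∀ z, ‖V z‖ ≤ ‖U z‖ := fun z => enorm_le_iff_norm_le.1 (hVU z)
      rw [norm_mul (V w), norm_mul (U w)]
      exact mul_le_mul (h5 _) (h5 _) (norm_nonneg _) (norm_nonneg _)
    rw [← integral_sub hi1 (h4.const_mul _)]
    refine integral_congr_ae (ae_of_all _ fun w => ?_)
    simp only [hV]
    push_cast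
    ring
  have hfb : ∀ᵐ z ∂μ, ENNReal.ofReal (|z.1| ^ (s - 9 / 40)) * ‖fourierL2 f z‖ₑ ≤ ‖c‖ₑ * G z := by
    filter_upwards [hfF] with z hz
    rw [hz, enorm_mul, mul_left_comm]
    gcongr
    have := ofReal_mul_enorm_integral_le (lam := lam) (s := s) (A := 1) U
      (fun _ => m (zeta lam z)) (|z.1| ^ (s - 9 / 40)) (by positivity) zero_le_one z fun w => ?_
    · simpa using this
    · rw [one_mul]
      have h1 := rpow_abs_fst_add_le (a := s - 9 / 40) (by linarith) (by linarith) (zeta lam w)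
        (zeta lam (z - w))
      rw [zeta_add_zeta_sub] at h1
      exact (mul_le_of_le_one_right (by positivity) (hmabs _)).trans h1
  have hgb : ∀ᵐ z ∂μ, ENNReal.ofReal (|z.1| ^ (49 / 40 - s)) *
      ‖fourierL2 (fun p => v p ^ 2 - f p) z‖ₑ
        ≤ ‖c‖ₑ * (ENNReal.ofReal (4 * N ^ (-(2 * s - 29 / 20))) * G z) := by
    filter_upwards [hgF] with z hz
    rw [hz, enorm_mul, mul_left_comm]
    gcongr ‖c‖ₑ * ?_
    refine ofReal_mul_enorm_integral_le (lam := lam) (s := s) U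
      (fun w => m (zeta lam w) * m (zeta lam (z - w)) - m (zeta lam z)) (|z.1| ^ (49 / 40 - s))
      (by positivity) (by positivity) z fun w => ?_
    have h1 := hm.commutator_le hN hs (zeta lam w) (zeta lam (z - w))
    rw [zeta_add_zeta_sub] at h1
    exact h1
  -- the absolutely convergent integral over the frequencies
  have hneg := (Measure.measurePreserving_neg μ).quasiMeasurePreserving.ae hfb
  have hK : ∫⁻ z, ‖z.1‖ₑ * (‖fourierL2 f (-z)‖ₑ * ‖fourierL2 (fun p => v p ^ 2 - f p) z‖ₑ) ∂μ
      ≤ ‖c‖ₑ ^ 2 * 64 * bilinearConst s b * ENNReal.ofReal (N ^ (-(2 * s - 29 / 20))) * X ^ 4 := by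
    have hpt : ∀ᵐ z ∂μ, ‖z.1‖ₑ * (‖fourierL2 f (-z)‖ₑ *
        ‖fourierL2 (fun p => v p ^ 2 - f p) z‖ₑ)
        ≤ ‖c‖ₑ ^ 2 * ENNReal.ofReal (4 * N ^ (-(2 * s - 29 / 20))) * (G (-z) * G z) := by
      filter_upwards [hneg, hgb] with z h1 h2
      -- The exponents add up to 1, and both are nonnegative because `31/40 < s ≤ 1`, so the
      -- identity also holds at `ξ = 0`.
      have e : ‖z.1‖ₑ = ENNReal.ofReal (|z.1| ^ (s - 9 / 40)) *
          ENNReal.ofReal (|z.1| ^ (49 / 40 - s)) := by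
        rw [← ENNReal.ofReal_mul (by positivity), ← Real.rpow_add_of_nonneg (abs_nonneg _)
          (by linarith) (by linarith), ← ofReal_norm, Real.norm_eq_abs]
        norm_num
      rw [Prod.fst_neg, abs_neg] at h1
      calc _ = (ENNReal.ofReal (|z.1| ^ (s - 9 / 40)) * ‖fourierL2 f (-z)‖ₑ) *
            (ENNReal.ofReal (|z.1| ^ (49 / 40 - s)) *
              ‖fourierL2 (fun p => v p ^ 2 - f p) z‖ₑ) := by rw [e]; ring
        _ ≤ (‖c‖ₑ * G (-z)) *
            (‖c‖ₑ * (ENNReal.ofReal (4 * N ^ (-(2 * s - 29 / 20))) * G z)) := by gcongr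
        _ = _ := by ring
    refine (lintegral_mono_ae hpt).trans ?_
    rw [lintegral_const_mul' _ _ (by finiteness), ENNReal.ofReal_mul (by norm_num)]
    have h4 : ENNReal.ofReal 4 = 4 := by norm_num
    rw [h4]
    -- The constant 64 is the 4 of the commutator bound times `4²` from comparing the two norms.
    calc _ ≤ ‖c‖ₑ ^ 2 * (4 * ENNReal.ofReal (N ^ (-(2 * s - 29 / 20)))) *
          (bilinearConst s b * (4 * X ^ 2) ^ 2) := by
          gcongr
          exact (lintegral_neg_mul_le hGm).trans hGE
      _ = _ := by ring
  have hKfin : ‖c‖ₑ ^ 2 * 64 * bilinearConst s b * ENNReal.ofReal (N ^ (-(2 * s - 29 / 20))) * X ^ 4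
      ≠ ⊤ := by
    have := bilinearConst_ne_top hs hb
    finiteness
  refine ⟨_, hasIntegralMulDx_of_fourierL2 hf.1 hg (ne_top_of_le_ne_top hKfin hK), ?_⟩
  rw [enorm_mul]
  have h1 : ‖∫ z, Complex.I * z.1 * (fourierL2 f (-z) *
      fourierL2 (fun p => v p ^ 2 - f p) z) ∂μ‖ₑ ≤ ‖c‖ₑ ^ 2 * 64 * bilinearConst s b *
        ENNReal.ofReal (N ^ (-(2 * s - 29 / 20))) * X ^ 4 := by
    refine ((enorm_integral_le_lintegral_enorm _).trans_eq ?_).trans hK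
    refine lintegral_congr fun z => ?_
    rw [enorm_mul, enorm_mul, enorm_mul, ← ofReal_norm Complex.I, Complex.norm_I,
      ENNReal.ofReal_one, one_mul, ← ofReal_norm, Complex.norm_real, ofReal_norm]
  calc ‖c‖ₑ * _ ≤ ‖c‖ₑ * (‖c‖ₑ ^ 2 * 64 * bilinearConst s b *
        ENNReal.ofReal (N ^ (-(2 * s - 29 / 20))) * X ^ 4) := by gcongr
    _ = _ := by ring

end Main

end ZK

theorem lemma4p4 (s : ℝ) (hs : 31 / 40 < s) :
    ∃ ε : ℝ, 0 < ε ∧ ∀ b : ℝ, 1 / 2 < b → ∃ C : ℝ, 0 < C ∧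
      ∀ (lam : ℝ) [Fact (0 < 2 * Real.pi * lam)], 1 < lam →
      ∀ (N : ℝ), (∃ k : ℕ, N = 2 ^ k) →
      ∀ (m : ℝ × ℝ → ℝ), ZK.IsISymbol s N m →
      ∀ (u : ZK.Cyl lam → ℂ), MemLp u 2 volume →
        ZK.bourgainNorm 1 b (ZK.multiplierOp m u) ≠ ⊤ →
        -- the products are square-integrable, so that `I` applies to `u²`
        MemLp (fun p => u p ^ 2) 2 volume ∧
        MemLp (fun p => ZK.multiplierOp m u p ^ 2) 2 volume ∧
        -- the integral of `I(u²) ∂_x ((I u)² - I(u²))` exists and obeys the bound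
        ∃ J : ℂ,
          ZK.HasIntegralMulDx
            (ZK.multiplierOp m (fun p => u p ^ 2))
            (fun p => ZK.multiplierOp m u p ^ 2 - ZK.multiplierOp m (fun q => u q ^ 2) p) J ∧
          ‖J‖ ≤ C * N ^ (-(1 / 10 + ε)) *
            (ZK.bourgainNorm 1 b (ZK.multiplierOp m u)).toReal ^ 4 := by
  -- This `ε` is positive exactly for `s > 31/40`, and `1/10 + ε = 2s - 29/20` is the gain from the
  -- commutator.
  refine ⟨2 * s - 31 / 20, by linarith, fun b hb => ?_⟩
  set A : ℝ≥0∞ := ‖(ZK.cylConst : ℂ)⁻¹‖ₑ ^ 3 * 64 * ZK.bilinearConst s b with hA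
  have hAfin : A ≠ ⊤ := by
    have := ZK.bilinearConst_ne_top hs hb
    finiteness
  -- The constant depends only on `s` and `b`; adding 1 merely makes it positive.
  refine ⟨A.toReal + 1, by positivity, ?_⟩
  intro lam _ hlam N hN m hm u hu hfin
  have hN1 : 1 ≤ N := by
    obtain ⟨k, rfl⟩ := hN
    exact one_le_pow₀ (by norm_num)
  obtain ⟨h1, h2, J, h3, h4⟩ := ZK.energy_increment_bound hs hb hlam hN1 hm hu hfin
  refine ⟨h1, h2, J, h3, ?_⟩
  have h5 := ENNReal.toReal_mono (by finiteness) h4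
  rw [toReal_enorm, ENNReal.toReal_mul, ENNReal.toReal_mul, ENNReal.toReal_pow,
    ENNReal.toReal_ofReal (by positivity)] at h5
  have e : (1 / 10 + (2 * s - 31 / 20)) = 2 * s - 29 / 20 := by ring
  rw [e]
  refine h5.trans ?_
  gcongr
  linarith
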